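/- Let $K$ be a field, let $k \geq 2$, and let $D=(V,E,w)$ be a weighted oriented graph: $V=\{x_1,\dots,x_k\}$ is a finite set, $E\subseteq V\times V$ contains no loops and never both $(x,y)$ and $(y,x)$, and $w:V\to\{1,2,3,\dots\}$ is a weight function such that $w(x)=1$ for every source $x$ (a vertex $x$ with no edge $(y,x)\in E$). Let $R=K[x_1,\dots,x_k]$ and let $I(D)=(x_i x_j^{w(x_j)} : (x_i,x_j)\in E)\subseteq R$ be the edge ideal of $D$. Suppose that the underlying simple graph of $D$ is the path $(x_1,\dots,x_k)$, that is, its edges are exactly $\{x_i,x_{i+1}\}$ for $1\le i<k$. Then the following conditions are equivalent: 1. The ring $R/I(D)$ is Cohen–Macaulay. 2. $I(D)$ is unmixed, that is, all associated primes of $I(D)$ have the same height. 3. Either $k=2$, or $k=4$ and both of the following hold: if $(x_2,x_1)\in E$ then $w(x_2)=1$; and if $(x_3,x_4)\in E$ then $w(x_3)=1$. -/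

import Mathlib

/-- A weighted oriented graph with vertex set `V`: each edge carries exactly one direction (so
there are no loops and no pairs of opposite edges), and each vertex has a positive weight. -/
structure WeightedOrientedGraph (V : Type*) extends Digraph V where
  asymm : ∀ x y, Adj x y → ¬ Adj y x
  weight : V → ℕ
  weight_pos : ∀ x, 0 < weight x

namespace WeightedOrientedGraph

variable {V : Type*} (D : WeightedOrientedGraph V)

/-- The underlying simple graph, with edges `{x, y}` for the directed edges `(x, y)`. -/
def underlyingGraph : SimpleGraph V := D.toDigraph.toSimpleGraphInclusive

/-- A source: every neighbour of `x` is an out-neighbour of `x`. -/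
def IsSource (x : V) : Prop := {y | D.Adj x y ∨ D.Adj y x} = {y | D.Adj x y}

/-- The edge ideal `I(D)`, generated by the monomials `x * y ^ w(y)` for the edges `(x, y)`. -/
noncomputable def edgeIdeal (K : Type*) [Field K] : Ideal (MvPolynomial V K) :=
  Ideal.span {f | ∃ x y, D.Adj x y ∧ f = MvPolynomial.X x * MvPolynomial.X y ^ D.weight y}

end WeightedOrientedGraph

/-- An ideal `I` is unmixed if all associated primes of `R ⧸ I` have the same height. -/
def Ideal.IsUnmixed {R : Type*} [CommRing R] (I : Ideal R) : Prop :=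
  ∀ p ∈ associatedPrimes R (R ⧸ I), ∀ q ∈ associatedPrimes R (R ⧸ I), p.height = q.height

/-- The depth of a local ring: the supremum of the lengths of the regular sequences contained in
the maximal ideal. -/
noncomputable def localRingDepth (A : Type*) [CommRing A] [IsLocalRing A] : ℕ∞ :=
  ⨆ rs : {rs : List A //
      (∀ r ∈ rs, r ∈ IsLocalRing.maximalIdeal A) ∧ RingTheory.Sequence.IsRegular A rs},
    (rs.1.length : ℕ∞)

/-- A Noetherian ring is Cohen-Macaulay if its localization at each maximal ideal has depth equal
to its Krull dimension. -/
def IsCohenMacaulayRing (A : Type*) [CommRing A] : Prop :=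
  IsNoetherianRing A ∧ ∀ (m : Ideal A) [m.IsMaximal],
    (localRingDepth (Localization.AtPrime m) : WithBot ℕ∞) =
      ringKrullDim (Localization.AtPrime m)

/-! ### Depth bounds from associated primes. -/

section LocalDepth

open RingTheory.Sequence IsLocalRing
open scoped Pointwise

/-! Number the path from 0. Whatever the orientation, the edge between consecutive vertices `i` and
`i + 1` contributes a generator `xᵢ ^ αᵢ * xᵢ₊₁ ^ βᵢ`, so only inequalities between exponents
matter.

Positive direction. For `k = 4` the weight conditions give `α₁ ≤ β₀` and `β₁ ≤ α₂`. Taking the colon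
by, and the sum with, a monomial repeatedly then filters `R ⧸ I` with factors `R ⧸ p`, where `p` is
one of `(x₀, x₂)`, `(x₁, x₂)`, `(x₁, x₃)` (`hasPrimeFiltration_path`). All have height 2 and all
associated primes are among them, so `I` is unmixed. Modulo each `p`, the sums `x₀ + x₁` and `x₂ +
x₃` become the two surviving variables. Hence for a maximal ideal `M`, the minimal polynomials of
these sums over `M`, evaluated at the sums, give a sequence in `M` that is regular on every factor,
and so on `R ⧸ I`. Its length is the dimension, which gives Cohen–Macaulayness. The case `k = 2` is
the same with one sum and height 1.

Negative direction. Two associated primes generated by different numbers of variables refute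
unmixedness at once. They also refute Cohen–Macaulayness at the origin, because depth is at most the
coheight of any associated prime (`localRingDepth_quotient_le_coheight`,
`not_isCohenMacaulayRing_of_card_lt`). For `k = 3` or `k ≥ 5` the path has minimal vertex covers of
different sizes. For `k = 4`, a failing weight condition makes a three-variable prime associated
next to `(x₁, x₂)`. -/

theorem IsSMulRegular.notMem_of_mem_associatedPrimes {R M : Type*} [CommRing R] [IsNoetherianRing R] [AddCommGroup M] [Module R M]
    {p : Ideal R} (hp : p ∈ associatedPrimes R M) {r : R} (hreg : IsSMulRegular M r) :
    r ∉ p := by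
  intro hr
  obtain ⟨hpp, x, hx⟩ := isAssociatedPrime_iff.1 hp
  have h0 : r • x = 0 := by
    rw [hx] at hr
    simpa [Submodule.mem_colon_singleton] using hr
  have : x = 0 := hreg (by simpa using h0)
  subst this
  exact hpp.ne_top (hx.trans Submodule.colon_singleton_zero)

variable {R : Type*} [CommRing R] [IsNoetherianRing R] [IsLocalRing R]

/-- An associated prime of `M` can be enlarged to an associated prime of `M ⧸ rM` containing `r`. -/
theorem exists_mem_associatedPrimes_quotSMulTop {M : Type*} [AddCommGroup M] [Module R M]
    [Module.Finite R M] {p : Ideal R} (hp : p ∈ associatedPrimes R M) {r : R}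
    (hr : r ∈ maximalIdeal R) (hreg : IsSMulRegular M r) :
    ∃ q ∈ associatedPrimes R (QuotSMulTop r M), p ≤ q ∧ r ∈ q := by
  obtain ⟨hpp, x, hx⟩ := isAssociatedPrime_iff.1 hp
  -- `N` consists of the elements killed by `p`. By Nakayama `N ⧸ rN` is nonzero, and it is killed
  -- by `p` and `r`. It embeds in `M ⧸ rM`: if `rz ∈ N`, regularity of `r` forces `z ∈ N`.
  let N : Submodule R M := Submodule.torsionBySet R M p
  have hxN : x ∈ N := by
    rw [Submodule.mem_torsionBySet_iff]
    rintro ⟨a, ha⟩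
    rw [hx] at ha
    simpa [Submodule.mem_colon_singleton] using ha
  have hx0 : x ≠ 0 := by
    rintro rfl
    exact hpp.ne_top (hx.trans Submodule.colon_singleton_zero)
  have : Nontrivial N := ⟨⟨⟨x, hxN⟩, 0, fun h => hx0 (congrArg Subtype.val h)⟩⟩
  have : Nontrivial (QuotSMulTop r N) := nontrivial_quotSMulTop_of_mem_maximalIdeal N hr
  obtain ⟨q, hq⟩ := associatedPrimes.nonempty R (QuotSMulTop r N)
  have hann := IsAssociatedPrime.annihilator_le hq
  refine ⟨q, associatedPrimes.subset_of_injective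
    (f := QuotSMulTop.map r N.subtype) ?_ hq, ?_, ?_⟩
  · rw [injective_iff_map_eq_zero]
    intro y hy
    obtain ⟨y, rfl⟩ := Submodule.Quotient.mk_surjective _ y
    have hy' : (y : M) ∈ r • (⊤ : Submodule R M) := by
      rw [← Submodule.Quotient.mk_eq_zero]
      simpa using hy
    obtain ⟨z, -, hz⟩ := (Submodule.mem_smul_pointwise_iff_exists _ _ _).1 hy'
    rw [Submodule.Quotient.mk_eq_zero, Submodule.mem_smul_pointwise_iff_exists]
    refine ⟨⟨z, ?_⟩, trivial, Subtype.ext hz⟩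
    rw [Submodule.mem_torsionBySet_iff]
    intro a
    apply hreg
    have := (Submodule.mem_torsionBySet_iff _ _).1 y.2 a
    rw [← hz, smul_comm] at this
    simpa using this
  · intro a ha
    apply hann
    rw [Submodule.mem_annihilator]
    intro y _
    obtain ⟨y, rfl⟩ := Submodule.Quotient.mk_surjective _ y
    have := (Submodule.mem_torsionBySet_iff _ _).1 y.2 ⟨a, ha⟩
    rw [← Submodule.Quotient.mk_smul]
    have h0 : a • y = 0 := Subtype.ext this
    rw [h0, Submodule.Quotient.mk_zero]
  · apply hann
    rw [Submodule.mem_annihilator]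
    intro y _
    obtain ⟨y, rfl⟩ := Submodule.Quotient.mk_surjective _ y
    rw [← Submodule.Quotient.mk_smul, Submodule.Quotient.mk_eq_zero]
    exact Submodule.smul_mem_pointwise_smul _ _ _ trivial

/-- The length of a regular sequence on `M` is at most the dimension of `R ⧸ p` for every
associated prime `p` of `M`. -/
theorem length_le_coheight_of_isRegular {M : Type*} [AddCommGroup M] [Module R M]
    [Module.Finite R M] (rs : List R) (hmem : ∀ r ∈ rs, r ∈ maximalIdeal R)
    (hreg : IsRegular M rs) (p : PrimeSpectrum R) (hp : p.asIdeal ∈ associatedPrimes R M) :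
    (rs.length : ℕ∞) ≤ Order.coheight p := by
  induction rs generalizing M p with
  | nil => simp
  | cons r rs ih =>
    obtain ⟨h1, h2⟩ := (isRegular_cons_iff M r rs).1 hreg
    obtain ⟨q, hq, hpq, hrq⟩ := exists_mem_associatedPrimes_quotSMulTop hp (hmem r (by simp)) h1
    let q' : PrimeSpectrum R := ⟨q, hq.isPrime⟩
    -- A regular element avoids `p` but lies in `q`, so each entry of the sequence costs a strict
    -- step in a chain of primes.
    have hlt : p < q' := by
      refine lt_of_le_of_ne hpq ?_
      rintro rfl
      exact h1.notMem_of_mem_associatedPrimes hp hrq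
    have := ih (fun r hr => hmem r (by simp [hr])) h2 q' hq
    refine le_trans ?_ (Order.coheight_add_one_le hlt)
    push_cast [List.length_cons]
    gcongr

theorem localRingDepth_le_coheight (p : PrimeSpectrum R)
    (hp : p.asIdeal ∈ associatedPrimes R R) : localRingDepth R ≤ Order.coheight p :=
  iSup_le fun rs => length_le_coheight_of_isRegular rs.1 rs.2.1 rs.2.2 p hp

theorem localRingDepth_le_ringKrullDim : (localRingDepth R : WithBot ℕ∞) ≤ ringKrullDim R := by
  obtain ⟨p, hp⟩ := associatedPrimes.nonempty R R
  refine le_trans ?_ (Order.coheight_le_krullDim (⟨p, hp.isPrime⟩ : PrimeSpectrum R))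
  exact_mod_cast localRingDepth_le_coheight (⟨p, hp.isPrime⟩ : PrimeSpectrum R) hp

end LocalDepth

/-! ### Passing the depth bound to localizations of quotients. -/

section Localization

variable {R : Type*} [CommRing R] [IsNoetherianRing R]

/-- An associated prime `P ≤ m` of `R ⧸ I` bounds the depth of `(R ⧸ I)_m`. -/
theorem localRingDepth_quotient_le_coheight (I : Ideal R) (m : Ideal (R ⧸ I)) [m.IsPrime]
    (P : PrimeSpectrum R) (hP : P.asIdeal ∈ associatedPrimes R (R ⧸ I))
    (hPm : P.asIdeal ≤ m.comap (Ideal.Quotient.mk I)) :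
    localRingDepth (Localization.AtPrime m) ≤ Order.coheight P := by
  set A := Localization.AtPrime m
  obtain ⟨hPp, f, hf⟩ := isAssociatedPrime_iff.1 hP
  have hIP : I ≤ P.asIdeal := by
    intro a ha
    rw [hf, Submodule.mem_colon_singleton]
    simp [Algebra.smul_def, Ideal.Quotient.eq_zero_iff_mem.2 ha]
  let p : Ideal (R ⧸ I) := P.asIdeal.map (Ideal.Quotient.mk I)
  have hker : RingHom.ker (Ideal.Quotient.mk I) ≤ P.asIdeal := by rwa [Ideal.mk_ker]
  have hp : p.IsPrime := Ideal.map_isPrime_of_surjective Ideal.Quotient.mk_surjective hker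
  have hcomap : p.comap (Ideal.Quotient.mk I) = P.asIdeal := by
    rw [Ideal.comap_map_of_surjective' _ Ideal.Quotient.mk_surjective, sup_eq_left]
    exact hker
  have hpA : p ∈ associatedPrimes (R ⧸ I) (R ⧸ I) := by
    refine isAssociatedPrime_iff.2 ⟨hp, f, ?_⟩
    ext a
    obtain ⟨a, rfl⟩ := Ideal.Quotient.mk_surjective a
    rw [← Ideal.mem_comap, hcomap, hf, Submodule.mem_colon_singleton,
      Submodule.mem_colon_singleton]
    simp [Algebra.smul_def]
  have hpm : p ≤ m := Ideal.map_le_iff_le_comap.2 hPm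
  let q : Ideal A := p.map (algebraMap (R ⧸ I) A)
  have hdisj : Disjoint (m.primeCompl : Set (R ⧸ I)) p :=
    Set.disjoint_left.2 fun a ha hap => ha (hpm hap)
  have hq : q.IsPrime := IsLocalization.isPrime_of_isPrime_disjoint m.primeCompl A p hp hdisj
  have hqp : q.comap (algebraMap (R ⧸ I) A) = p :=
    IsLocalization.under_map_of_isPrime_disjoint m.primeCompl A hp hdisj
  have hqA : q ∈ associatedPrimes A A :=
    Module.associatedPrimes.mem_associatedPrimes_of_comap_mem_associatedPrimes_of_isLocalizedModule
      m.primeCompl (Algebra.linearMap (R ⧸ I) A) q (by rwa [hqp])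
  refine (localRingDepth_le_coheight ⟨q, hq⟩ hqA).trans ?_
  let g : R →+* A := (algebraMap (R ⧸ I) A).comp (Ideal.Quotient.mk I)
  -- The spectrum of `(R ⧸ I)_m` embeds strictly monotonically in that of `R`, so coheights can only
  -- grow.
  have hg : StrictMono (PrimeSpectrum.comap g) := by
    refine Monotone.strictMono_of_injective (fun a b h => Ideal.comap_mono h) ?_
    rw [PrimeSpectrum.comap_comp]
    exact (PrimeSpectrum.comap_injective_of_surjective _ Ideal.Quotient.mk_surjective).comp
      (PrimeSpectrum.localization_comap_injective A m.primeCompl)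
  refine (Order.coheight_le_coheight_apply_of_strictMono _ hg _).trans (le_of_eq ?_)
  congr 1
  ext1
  change Ideal.comap g q = P.asIdeal
  rw [← Ideal.comap_comap, hqp, hcomap]

end Localization

/-! ### Prime filtrations and what they transfer to `R ⧸ I`. -/

section PrimeFiltration

variable {R : Type*} [CommRing R]

/-- `R ⧸ I` has a finite filtration whose factors are isomorphic to `R ⧸ p` with `p ∈ Ps`. -/
inductive HasPrimeFiltration (Ps : Set (Ideal R)) : Ideal R → Prop
  | top : HasPrimeFiltration Ps ⊤
  | of_mem {p : Ideal R} (hp : p ∈ Ps) : HasPrimeFiltration Ps p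
  -- Here `J = (I : h)`, and the step is the exact sequence `0 → R ⧸ J → R ⧸ I → R ⧸ (I + (h)) → 0`.
  | of_colon {I J : Ideal R} (h : R) (hJ : ∀ f, f ∈ J ↔ h * f ∈ I)
      (hcolon : HasPrimeFiltration Ps J) (hsup : HasPrimeFiltration Ps (I ⊔ Ideal.span {h})) :
      HasPrimeFiltration Ps I

theorem mem_associatedPrimes_quotient_iff [IsNoetherianRing R] {I P : Ideal R} :
    P ∈ associatedPrimes R (R ⧸ I) ↔ P.IsPrime ∧ ∃ f, ∀ r, r ∈ P ↔ r * f ∈ I := by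
  rw [AssociatedPrimes.mem_iff, isAssociatedPrime_iff]
  refine and_congr_right fun _ => ?_
  rw [Ideal.Quotient.mk_surjective.exists]
  refine exists_congr fun f => ?_
  rw [SetLike.ext_iff]
  refine forall_congr' fun r => ?_
  rw [Submodule.mem_colon_singleton, Submodule.mem_bot, Algebra.smul_def,
    Ideal.Quotient.algebraMap_eq, ← map_mul, Ideal.Quotient.eq_zero_iff_mem]

theorem HasPrimeFiltration.associatedPrimes_subset [IsNoetherianRing R] {Ps : Set (Ideal R)}
    (hPs : ∀ p ∈ Ps, p.IsPrime) {I : Ideal R} (hI : HasPrimeFiltration Ps I) :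
    associatedPrimes R (R ⧸ I) ⊆ Ps := by
  induction hI with
  | top =>
    intro P hP
    obtain ⟨hp, f, hf⟩ := mem_associatedPrimes_quotient_iff.1 hP
    exact (hp.ne_top ((Ideal.eq_top_iff_one _).2 ((hf 1).2 trivial))).elim
  | @of_mem p hp =>
    intro P hP
    obtain ⟨hP', f, hf⟩ := mem_associatedPrimes_quotient_iff.1 hP
    have := hPs p hp
    have hfp : f ∉ p := fun h =>
      hP'.ne_top ((Ideal.eq_top_iff_one _).2 ((hf 1).2 (by simpa using h)))
    have : P = p := by
      ext r
      rw [hf, this.mul_mem_iff_mem_or_mem]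
      tauto
    rwa [this]
  | @of_colon I J h hJ _ _ ih1 ih2 =>
    intro P hP
    obtain ⟨hp, f, hf⟩ := mem_associatedPrimes_quotient_iff.1 hP
    -- If a multiple `rf` with `r ∉ P` equals `i + hg`, then `P` is the annihilator of `g` modulo
    -- `J`. Otherwise `P` is still the annihilator of `f` modulo `I + (h)`.
    by_cases hr : ∃ r, r ∉ P ∧ r * f ∈ I ⊔ Ideal.span {h}
    · obtain ⟨r, hrP, hrf⟩ := hr
      obtain ⟨i, hi, y, hy, hiy⟩ := Submodule.mem_sup.1 hrf
      obtain ⟨g, rfl⟩ := Ideal.mem_span_singleton'.1 hy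
      refine ih1 (mem_associatedPrimes_quotient_iff.2 ⟨hp, g, fun s => ?_⟩)
      have h1 : s ∈ P ↔ s * r ∈ P := by
        rw [hp.mul_mem_iff_mem_or_mem]
        tauto
      rw [h1, hf, hJ, show s * r * f = s * i + h * (s * g) by linear_combination -s * hiy]
      exact (I.add_mem_iff_right (I.mul_mem_left s hi))
    · push Not at hr
      refine ih2 (mem_associatedPrimes_quotient_iff.2 ⟨hp, f, fun s => ⟨fun hs => ?_, fun hs => ?_⟩⟩)
      · exact Ideal.mem_sup_left ((hf s).1 hs)
      · by_contra hsP
        exact hr s hsP hs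

theorem HasPrimeFiltration.exists_le {Ps : Set (Ideal R)} {I : Ideal R}
    (hI : HasPrimeFiltration Ps I) {Q : Ideal R} (hQ : Q.IsPrime) (hIQ : I ≤ Q) :
    ∃ p ∈ Ps, p ≤ Q := by
  induction hI with
  | top => exact (hQ.ne_top (top_le_iff.1 hIQ)).elim
  | of_mem hp => exact ⟨_, hp, hIQ⟩
  | of_colon h hJ _ _ ih1 ih2 =>
    by_cases hh : h ∈ Q
    · exact ih2 (sup_le hIQ ((Ideal.span_singleton_le_iff_mem _).2 hh))
    · exact ih1 fun f hf => (hQ.mem_or_mem (hIQ ((hJ f).1 hf))).resolve_left hh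

theorem HasPrimeFiltration.mem_of_mul_mem {Ps : Set (Ideal R)} {r : R}
    (hPs : ∀ p ∈ Ps, ∀ x, r * x ∈ p → x ∈ p) {I : Ideal R} (hI : HasPrimeFiltration Ps I)
    {x : R} (hx : r * x ∈ I) : x ∈ I := by
  induction hI generalizing x with
  | top => trivial
  | of_mem hp => exact hPs _ hp x hx
  | @of_colon I J h hJ _ _ ih1 ih2 =>
    obtain ⟨i, hi, y, hy, rfl⟩ := Submodule.mem_sup.1 (ih2 (Ideal.mem_sup_left hx))
    obtain ⟨c, rfl⟩ := Ideal.mem_span_singleton'.1 hy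
    refine I.add_mem hi ?_
    rw [mul_comm, ← hJ]
    refine ih1 ((hJ _).2 ?_)
    rw [← I.add_mem_iff_right (I.mul_mem_left r hi)]
    convert hx using 1
    ring

/-- Since `r` is regular on every factor, reducing modulo `r` keeps the filtration sequences exact.
Regularity of `s` modulo `r` therefore passes from the factors to `R ⧸ I`. -/
theorem HasPrimeFiltration.exists_sub_mul_mem {Ps : Set (Ideal R)} {r s : R}
    (hr : ∀ p ∈ Ps, ∀ x, r * x ∈ p → x ∈ p)
    (hs : ∀ p ∈ Ps, ∀ x y, s * x - r * y ∈ p → ∃ z, x - r * z ∈ p)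
    {I : Ideal R} (hI : HasPrimeFiltration Ps I)
    {x y : R} (hx : s * x - r * y ∈ I) : ∃ z, x - r * z ∈ I := by
  induction hI generalizing x y with
  | top => exact ⟨0, trivial⟩
  | of_mem hp => exact hs _ hp x y hx
  | @of_colon I J h hJ _ h2 ih1 ih2 =>
    obtain ⟨z, hz⟩ := ih2 (Ideal.mem_sup_left hx)
    obtain ⟨i, hi, t, ht, hxz⟩ := Submodule.mem_sup.1 hz
    obtain ⟨c, rfl⟩ := Ideal.mem_span_singleton'.1 ht
    have h3 : h * (s * c) + r * (s * z - y) ∈ I := by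
      rw [← I.add_mem_iff_right (I.mul_mem_left s hi)]
      convert hx using 1
      linear_combination s * hxz
    -- Regularity of `r` on `R ⧸ (I + (h))` is used here to cancel `r`.
    have h4 : s * z - y ∈ I ⊔ Ideal.span {h} := by
      refine h2.mem_of_mul_mem hr ?_
      rw [← Ideal.add_mem_iff_right _ (Ideal.mul_mem_right (s * c) _
        (Ideal.mem_sup_right (Ideal.mem_span_singleton_self h)))]
      exact Ideal.mem_sup_left h3
    obtain ⟨i', hi', t, ht, hzy⟩ := Submodule.mem_sup.1 h4
    obtain ⟨d, rfl⟩ := Ideal.mem_span_singleton'.1 ht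
    have h5 : s * c - r * (-d) ∈ J := by
      rw [hJ, ← I.add_mem_iff_right (I.mul_mem_left r hi')]
      convert h3 using 1
      linear_combination r * hzy
    obtain ⟨e, he⟩ := ih1 h5
    refine ⟨z + h * e, ?_⟩
    convert I.add_mem hi ((hJ _).1 he) using 1
    linear_combination -hxz

theorem HasPrimeFiltration.isWeaklyRegular_singleton {Ps : Set (Ideal R)} {r : R}
    (hr : ∀ p ∈ Ps, ∀ x, r * x ∈ p → x ∈ p) {I : Ideal R} (hI : HasPrimeFiltration Ps I) :
    RingTheory.Sequence.IsWeaklyRegular (R ⧸ I) [Ideal.Quotient.mk I r] := by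
  rw [RingTheory.Sequence.isWeaklyRegular_singleton_iff, isSMulRegular_iff_right_eq_zero_of_smul]
  intro x hx
  obtain ⟨x, rfl⟩ := Ideal.Quotient.mk_surjective x
  rw [smul_eq_mul, ← map_mul, Ideal.Quotient.eq_zero_iff_mem] at hx
  rw [Ideal.Quotient.eq_zero_iff_mem]
  exact hI.mem_of_mul_mem hr hx

theorem HasPrimeFiltration.isWeaklyRegular_pair {Ps : Set (Ideal R)} {r s : R}
    (hr : ∀ p ∈ Ps, ∀ x, r * x ∈ p → x ∈ p)
    (hs : ∀ p ∈ Ps, ∀ x y, s * x - r * y ∈ p → ∃ z, x - r * z ∈ p)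
    {I : Ideal R} (hI : HasPrimeFiltration Ps I) :
    RingTheory.Sequence.IsWeaklyRegular (R ⧸ I)
      [Ideal.Quotient.mk I r, Ideal.Quotient.mk I s] := by
  rw [RingTheory.Sequence.isWeaklyRegular_cons_iff]
  refine ⟨(RingTheory.Sequence.isWeaklyRegular_singleton_iff _ _).1
    (hI.isWeaklyRegular_singleton hr), ?_⟩
  rw [RingTheory.Sequence.isWeaklyRegular_singleton_iff, isSMulRegular_iff_right_eq_zero_of_smul]
  intro x hx
  obtain ⟨x, rfl⟩ := Submodule.Quotient.mk_surjective _ x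
  obtain ⟨x, rfl⟩ := Ideal.Quotient.mk_surjective x
  rw [← Submodule.Quotient.mk_smul, Submodule.Quotient.mk_eq_zero,
    Submodule.mem_smul_pointwise_iff_exists] at hx
  obtain ⟨y, -, hy⟩ := hx
  obtain ⟨y, rfl⟩ := Ideal.Quotient.mk_surjective y
  rw [smul_eq_mul, smul_eq_mul, ← map_mul, ← map_mul, eq_comm, Ideal.Quotient.eq] at hy
  obtain ⟨z, hz⟩ := hI.exists_sub_mul_mem hr hs hy
  rw [Submodule.Quotient.mk_eq_zero, Submodule.mem_smul_pointwise_iff_exists]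
  refine ⟨Ideal.Quotient.mk I z, trivial, ?_⟩
  rw [smul_eq_mul, ← map_mul, eq_comm, Ideal.Quotient.eq]
  exact hz

end PrimeFiltration

/-! ### A Cohen–Macaulay criterion for quotients. -/

section Criterion

variable {R : Type*} [CommRing R]

/-- A chain of primes above `I` starts at a prime of height at least `c`, so a chain of length `c`
can be prepended to it. -/
theorem ringKrullDim_quotient_le_of_forall_le_height {I : Ideal R} {c n : ℕ}
    (hdim : ringKrullDim R ≤ (c + n : ℕ))
    (hI : ∀ Q : Ideal R, Q.IsPrime → I ≤ Q → (c : ℕ∞) ≤ Q.height) :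
    ringKrullDim (R ⧸ I) ≤ n := by
  refine iSup_le fun l => ?_
  let f := PrimeSpectrum.comap (Ideal.Quotient.mk I)
  have hf : StrictMono f := Monotone.strictMono_of_injective (fun a b h => Ideal.comap_mono h)
    (PrimeSpectrum.comap_injective_of_surjective _ Ideal.Quotient.mk_surjective)
  have hle : (c : ℕ∞) ≤ Order.height (f l.head) := by
    rw [← PrimeSpectrum.height_eq_orderHeight]
    refine hI _ (f l.head).2 fun a ha => ?_
    change Ideal.Quotient.mk I a ∈ l.head.asIdeal
    rw [Ideal.Quotient.eq_zero_iff_mem.2 ha]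
    exact zero_mem _
  obtain ⟨q, hq, hqc⟩ := Order.exists_series_of_le_height _ hle
  let t : LTSeries (PrimeSpectrum R) := q.smash (l.map f hf) (by simpa using hq)
  have ht : t.length = c + l.length := by simp [t, hqc]
  have := (Order.LTSeries.length_le_krullDim t).trans hdim
  rw [ht] at this
  have h2 : c + l.length ≤ c + n := by exact_mod_cast this
  exact_mod_cast Nat.le_of_add_le_add_left h2

/-- If every maximal ideal above `I` contains a regular sequence on `R ⧸ I` of length
`dim R - c` and all primes above `I` have height at least `c`, then `R ⧸ I` is
Cohen-Macaulay. -/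
theorem isCohenMacaulayRing_quotient [IsNoetherianRing R] {I : Ideal R} {c n : ℕ}
    (hdim : ringKrullDim R ≤ (c + n : ℕ))
    (hI : ∀ Q : Ideal R, Q.IsPrime → I ≤ Q → (c : ℕ∞) ≤ Q.height)
    (hreg : ∀ M : Ideal R, M.IsMaximal → I ≤ M → ∃ rs : List R, rs.length = n ∧
      (∀ r ∈ rs, r ∈ M) ∧
      RingTheory.Sequence.IsWeaklyRegular (R ⧸ I) (rs.map (Ideal.Quotient.mk I))) :
    IsCohenMacaulayRing (R ⧸ I) := by
  refine ⟨inferInstance, fun m hm => le_antisymm localRingDepth_le_ringKrullDim ?_⟩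
  have hM : (m.comap (Ideal.Quotient.mk I)).IsMaximal :=
    Ideal.comap_isMaximal_of_surjective _ Ideal.Quotient.mk_surjective
  obtain ⟨rs, hlen, hmem, hrs⟩ := hreg _ hM fun a ha => by
    rw [Ideal.mem_comap, Ideal.Quotient.eq_zero_iff_mem.2 ha]
    exact zero_mem _
  have hrs' := hrs.isRegular_of_isLocalization_of_mem (Localization.AtPrime m) m (by
    simpa using hmem)
  have h1 : (n : ℕ∞) ≤ localRingDepth (Localization.AtPrime m) := by
    refine le_trans ?_ (le_iSup _ ⟨_, ?_, hrs'⟩)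
    · simp [hlen]
    · intro r hr
      simp only [List.map_map, List.mem_map] at hr
      obtain ⟨a, ha, rfl⟩ := hr
      exact (IsLocalization.AtPrime.to_map_mem_maximal_iff _ m _).2 (hmem a ha)
  have h2 : ringKrullDim (Localization.AtPrime m) ≤ n := by
    rw [IsLocalization.AtPrime.ringKrullDim_eq_height m]
    exact Ideal.height_le_ringKrullDim_of_isPrime.trans
      (ringKrullDim_quotient_le_of_forall_le_height hdim hI)
  exact h2.trans (by exact_mod_cast h1)

end Criterion

/-! ### Monomial ideals as upper sets of exponents, and primes generated by variables. -/

open MvPolynomial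

section MonomialIdeal

variable {σ K : Type*} [Field K]

theorem mem_restrictSupportIdeal_iff {U : Set (σ →₀ ℕ)} {hU : IsUpperSet U}
    {f : MvPolynomial σ K} :
    f ∈ restrictSupportIdeal (R := K) U hU ↔ ∀ m, f.coeff m ≠ 0 → m ∈ U := by
  change (f.support : Set (σ →₀ ℕ)) ⊆ U ↔ _
  simp [Set.subset_def]

theorem monomial_mul_mem_restrictSupportIdeal_iff {U U' : Set (σ →₀ ℕ)} {hU : IsUpperSet U}
    {hU' : IsUpperSet U'} {t : σ →₀ ℕ} (h : ∀ m, m ∈ U' ↔ t + m ∈ U) (f : MvPolynomial σ K) :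
    f ∈ restrictSupportIdeal (R := K) U' hU' ↔
      monomial t 1 * f ∈ restrictSupportIdeal (R := K) U hU := by
  classical
  simp only [mem_restrictSupportIdeal_iff, coeff_monomial_mul', one_mul]
  constructor
  · intro hf m hm
    split_ifs at hm with htm
    · have := (h _).1 (hf _ hm)
      rwa [add_tsub_cancel_of_le htm] at this
    · exact (hm rfl).elim
  · intro hf m hm
    refine (h m).2 (hf _ ?_)
    rwa [if_pos le_self_add, add_tsub_cancel_left]

theorem restrictSupportIdeal_sup_span_monomial {U U' : Set (σ →₀ ℕ)} {hU : IsUpperSet U}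
    {hU' : IsUpperSet U'} {t : σ →₀ ℕ} (h : ∀ m, m ∈ U' ↔ m ∈ U ∨ t ≤ m) :
    restrictSupportIdeal (R := K) U hU ⊔ Ideal.span {monomial t 1} =
      restrictSupportIdeal (R := K) U' hU' := by
  classical
  refine le_antisymm (sup_le (fun f hf => ?_) ?_) fun f hf => ?_
  · rw [mem_restrictSupportIdeal_iff] at hf ⊢
    exact fun m hm => (h m).2 (Or.inl (hf m hm))
  · rw [Ideal.span_singleton_le_iff_mem, mem_restrictSupportIdeal_iff]
    intro m hm
    rw [coeff_monomial] at hm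
    split_ifs at hm with htm
    · exact (h m).2 (Or.inr htm.le)
    · exact (hm rfl).elim
  · rw [mem_restrictSupportIdeal_iff] at hf
    rw [f.as_sum]
    refine Ideal.sum_mem _ fun m hm => ?_
    rw [mem_support_iff] at hm
    rcases (h m).1 (hf m hm) with hmU | htm
    · refine Ideal.mem_sup_left (mem_restrictSupportIdeal_iff.2 fun m' hm' => ?_)
      rw [coeff_monomial] at hm'
      split_ifs at hm' with h'
      · exact h' ▸ hmU
      · exact (hm' rfl).elim
    · refine Ideal.mem_sup_right (Ideal.mem_span_singleton'.2 ⟨monomial (m - t) (f.coeff m), ?_⟩)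
      rw [monomial_mul, mul_one, tsub_add_cancel_of_le htm]

/-- Colon by a monomial translates the exponent set and adding a monomial adjoins a cone, so a
filtration step reduces to arithmetic on exponents. -/
theorem HasPrimeFiltration.restrictSupportIdeal {Ps : Set (Ideal (MvPolynomial σ K))}
    {U : Set (σ →₀ ℕ)} (hU : IsUpperSet U) (U₁ U₂ : Set (σ →₀ ℕ)) (t : σ →₀ ℕ)
    (h₁ : ∀ m, m ∈ U₁ ↔ t + m ∈ U) (h₂ : ∀ m, m ∈ U₂ ↔ m ∈ U ∨ t ≤ m)
    (H₁ : ∀ hU₁, HasPrimeFiltration Ps (MvPolynomial.restrictSupportIdeal (R := K) U₁ hU₁))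
    (H₂ : ∀ hU₂, HasPrimeFiltration Ps (MvPolynomial.restrictSupportIdeal (R := K) U₂ hU₂)) :
    HasPrimeFiltration Ps (MvPolynomial.restrictSupportIdeal (R := K) U hU) := by
  have hU₁ : IsUpperSet U₁ := fun a b hab ha =>
    (h₁ b).2 (hU (add_le_add_right hab t) ((h₁ a).1 ha))
  have hU₂ : IsUpperSet U₂ := fun a b hab ha =>
    (h₂ b).2 (((h₂ a).1 ha).imp (hU hab) fun h => h.trans hab)
  refine .of_colon (monomial t 1) (monomial_mul_mem_restrictSupportIdeal_iff h₁) (H₁ hU₁) ?_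
  rw [restrictSupportIdeal_sup_span_monomial h₂]
  exact H₂ hU₂

theorem restrictSupportIdeal_eq_top {U : Set (σ →₀ ℕ)} {hU : IsUpperSet U} (h : 0 ∈ U) :
    restrictSupportIdeal (R := K) U hU = ⊤ :=
  eq_top_iff.2 fun _ _ => mem_restrictSupportIdeal_iff.2 fun _ _ => hU (zero_le) h

variable (K) in
/-- The ideal generated by the variables indexed by `S`. -/
noncomputable def varsIdeal (S : Set σ) : Ideal (MvPolynomial σ K) := Ideal.span (X '' S)

theorem mem_varsIdeal_iff {S : Set σ} {f : MvPolynomial σ K} :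
    f ∈ varsIdeal K S ↔ ∀ m, f.coeff m ≠ 0 → ∃ i ∈ S, m i ≠ 0 := by
  rw [varsIdeal, mem_ideal_span_X_image]
  simp

theorem X_mem_varsIdeal_iff {S : Set σ} {i : σ} :
    (X i : MvPolynomial σ K) ∈ varsIdeal K S ↔ i ∈ S := by
  classical
  rw [mem_varsIdeal_iff]
  simp [coeff_X, Finsupp.single_apply]

theorem varsIdeal_mono {S T : Set σ} (h : S ⊆ T) : varsIdeal K S ≤ varsIdeal K T :=
  Ideal.span_mono (Set.image_mono h)

theorem restrictSupportIdeal_eq_varsIdeal {U : Set (σ →₀ ℕ)} {hU : IsUpperSet U} {S : Set σ}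
    (h : ∀ m, m ∈ U ↔ ∃ i ∈ S, m i ≠ 0) :
    restrictSupportIdeal (R := K) U hU = varsIdeal K S := by
  ext f
  simp only [mem_restrictSupportIdeal_iff, mem_varsIdeal_iff, h]

/-- Modulo the variables in `S`, `ψ ∘ φ` is the identity, so anything killed by `φ` lies in the
ideal. This identifies the quotient with concrete rings. -/
theorem ker_eq_varsIdeal {B : Type*} [CommRing B] [Algebra K B] {S : Set σ}
    (φ : MvPolynomial σ K →ₐ[K] B) (ψ : B →ₐ[K] MvPolynomial σ K)
    (h0 : ∀ i ∈ S, φ (X i) = 0) (h : ∀ i, i ∉ S → ψ (φ (X i)) = X i) :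
    RingHom.ker φ = varsIdeal K S := by
  refine le_antisymm (fun f hf => ?_) ?_
  · have key : (Ideal.Quotient.mkₐ K (varsIdeal K S)).comp (ψ.comp φ) =
        Ideal.Quotient.mkₐ K (varsIdeal K S) := by
      ext i
      by_cases hi : i ∈ S
      · have : X i ∈ varsIdeal K S := X_mem_varsIdeal_iff.2 hi
        simp [h0 i hi, Ideal.Quotient.eq_zero_iff_mem.2 this]
      · simp [h i hi]
    have := DFunLike.congr_fun key f
    rw [RingHom.mem_ker] at hf
    simp only [AlgHom.comp_apply, hf, map_zero, Ideal.Quotient.mkₐ_eq_mk] at this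
    exact Ideal.Quotient.eq_zero_iff_mem.1 this.symm
  · rw [varsIdeal, Ideal.span_le]
    rintro _ ⟨i, hi, rfl⟩
    exact h0 i hi

instance varsIdeal_isPrime (S : Set σ) : (varsIdeal K S).IsPrime := by
  classical
  rw [← ker_eq_varsIdeal (S := S) (aeval fun i => if i ∈ S then (0 : MvPolynomial σ K) else X i)
    (AlgHom.id K _) (fun i hi => by simp [hi]) (fun i hi => by simp [hi])]
  exact RingHom.ker_isPrime _

theorem varsIdeal_mem_associatedPrimes [Finite σ] {U : Set (σ →₀ ℕ)} {hU : IsUpperSet U}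
    {S : Set σ} (t : σ →₀ ℕ) (h : ∀ m, t + m ∈ U ↔ ∃ i ∈ S, m i ≠ 0) :
    varsIdeal K S ∈ associatedPrimes (MvPolynomial σ K)
      (MvPolynomial σ K ⧸ restrictSupportIdeal (R := K) U hU) := by
  refine mem_associatedPrimes_quotient_iff.2 ⟨inferInstance, monomial t 1, fun f => ?_⟩
  have hU' : IsUpperSet {m : σ →₀ ℕ | ∃ i ∈ S, m i ≠ 0} := by
    rintro a b hab ⟨i, hi, hai⟩
    exact ⟨i, hi, fun h => hai (Nat.le_zero.1 (h ▸ hab i))⟩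
  rw [← restrictSupportIdeal_eq_varsIdeal (hU := hU') (fun m => Iff.rfl), mul_comm]
  exact monomial_mul_mem_restrictSupportIdeal_iff (fun m => (h m).symm) f

end MonomialIdeal

/-! ### Heights, coheights and dimension at the origin. -/

section Height

variable {σ : Type*} (K : Type*) [Field K]

/-- The prime ideal generated by a set of variables, as a point of the spectrum. -/
noncomputable def varsPoint (S : Finset σ) : PrimeSpectrum (MvPolynomial σ K) :=
  ⟨varsIdeal K S, inferInstance⟩

theorem varsPoint_strictMono : StrictMono (varsPoint K (σ := σ)) := by
  refine Monotone.strictMono_of_injective (fun S T h => varsIdeal_mono (by exact_mod_cast h)) ?_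
  intro S T h
  ext i
  have : varsIdeal K (S : Set σ) = varsIdeal K (T : Set σ) := congrArg PrimeSpectrum.asIdeal h
  rw [← Finset.mem_coe, ← X_mem_varsIdeal_iff (K := K), this, X_mem_varsIdeal_iff, Finset.mem_coe]

theorem Finset.card_le_height (S : Finset σ) : (S.card : ℕ∞) ≤ Order.height S := by
  classical
  induction S using Finset.induction_on with
  | empty => simp
  | insert a S ha ih =>
    rw [Finset.card_insert_of_notMem ha]
    refine le_trans ?_ (Order.height_add_one_le (Finset.ssubset_insert ha))
    push_cast
    gcongr

/-- The upper bound is Krull's height theorem; the lower bound is a chain of primes generated by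
growing subsets of `S`. -/
theorem height_varsIdeal [Finite σ] (S : Finset σ) : (varsIdeal K (S : Set σ)).height = S.card := by
  classical
  refine le_antisymm ?_ ?_
  · have h : varsIdeal K (S : Set σ) ∈ (Ideal.span
        ((S.image X : Finset (MvPolynomial σ K)) : Set (MvPolynomial σ K))).minimalPrimes := by
      rw [Finset.coe_image, ← varsIdeal, Ideal.minimalPrimes_eq_subsingleton_self]
      rfl
    refine (Ideal.height_le_card_of_mem_minimalPrimes_span_finset h).trans ?_
    exact_mod_cast Finset.card_image_le
  · exact (S.card_le_height.trans (Order.height_le_height_apply_of_strictMono _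
      (varsPoint_strictMono K) S)).trans
      (PrimeSpectrum.height_eq_orderHeight (varsPoint K S)).ge

theorem coheight_varsPoint_le [Fintype σ] (S : Finset σ) :
    Order.coheight (varsPoint K S) + S.card ≤ Fintype.card σ := by
  have h := Order.krullDim_eq_iSup_height_add_coheight_of_nonempty
    (α := PrimeSpectrum (MvPolynomial σ K))
  have h1 : Order.krullDim (PrimeSpectrum (MvPolynomial σ K)) = Fintype.card σ := by
    have := MvPolynomial.ringKrullDim_of_isNoetherianRing (R := K) (ι := σ)
    rw [ringKrullDim_eq_zero_of_field, zero_add, Nat.card_eq_fintype_card] at this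
    exact this
  rw [h1] at h
  have h2 : (Fintype.card σ : ℕ∞) = ⨆ a : PrimeSpectrum (MvPolynomial σ K),
    Order.height a + Order.coheight a := by exact_mod_cast h
  rw [h2, ← height_varsIdeal K S, add_comm]
  refine le_trans (le_of_eq ?_) (le_iSup _ (varsPoint K S))
  rw [← PrimeSpectrum.height_eq_orderHeight]
  rfl

/-- If `I` is contained in `varsIdeal K T` then the localization of the quotient by `I` at the
origin has dimension at least the number of variables outside `T`. -/
theorem card_compl_le_ringKrullDim_localization [Fintype σ] [DecidableEq σ]
    {I : Ideal (MvPolynomial σ K)}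
    {T : Finset σ} (hI : I ≤ varsIdeal K T) (m : Ideal (MvPolynomial σ K ⧸ I)) [m.IsPrime]
    (hm : m.comap (Ideal.Quotient.mk I) = varsIdeal K Set.univ) :
    (Tᶜ.card : WithBot ℕ∞) ≤ ringKrullDim (Localization.AtPrime m) := by
  rw [IsLocalization.AtPrime.ringKrullDim_eq_height m (Localization.AtPrime m)]
  have hle : ∀ W : Finset {i // i ∉ T}, I ≤ varsIdeal K ((T : Set σ) ∪ (↑) '' (W : Set {i // i ∉ T})) :=
    fun W => hI.trans (varsIdeal_mono Set.subset_union_left)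
  -- Adjoining sets of variables outside `T` gives a Boolean lattice of primes with top `m`, so `m`
  -- has height at least the size of the complement.
  let f : Finset {i // i ∉ T} → PrimeSpectrum (MvPolynomial σ K ⧸ I) := fun W =>
    ⟨(varsIdeal K ((T : Set σ) ∪ (↑) '' (W : Set {i // i ∉ T}))).map (Ideal.Quotient.mk I),
      Ideal.map_isPrime_of_surjective Ideal.Quotient.mk_surjective
        (by rw [Ideal.mk_ker]; exact hle W)⟩
  have hfc : ∀ W, (f W).asIdeal.comap (Ideal.Quotient.mk I) =
      varsIdeal K ((T : Set σ) ∪ (↑) '' (W : Set {i // i ∉ T})) := fun W => by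
    rw [Ideal.comap_map_of_surjective' _ Ideal.Quotient.mk_surjective, sup_eq_left, Ideal.mk_ker]
    exact hle W
  have hf : StrictMono f := by
    refine Monotone.strictMono_of_injective (fun V W h => Ideal.map_mono (varsIdeal_mono ?_)) ?_
    · exact Set.union_subset_union_right _ (Set.image_mono (by exact_mod_cast h))
    · intro V W h
      have h1 : varsIdeal K ((T : Set σ) ∪ (↑) '' (V : Set {i // i ∉ T})) =
          varsIdeal K ((T : Set σ) ∪ (↑) '' (W : Set {i // i ∉ T})) := by
        rw [← hfc, h, hfc]
      ext i
      have := X_mem_varsIdeal_iff (K := K) (i := i.1) (S := (T : Set σ) ∪ (↑) '' (V : Set {i // i ∉ T}))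
      rw [h1, X_mem_varsIdeal_iff] at this
      simpa [i.2] using this.symm
  have hlast : f Finset.univ = ⟨m, inferInstance⟩ := by
    ext1
    refine Ideal.comap_injective_of_surjective _ Ideal.Quotient.mk_surjective ?_
    rw [hfc, hm]
    congr 1
    ext i
    simp [em]
  have h1 := (Finset.card_le_height _).trans (Order.height_le_height_apply_of_strictMono f hf Finset.univ)
  rw [hlast, ← PrimeSpectrum.height_eq_orderHeight] at h1
  have h2 : Fintype.card {i // i ∉ T} = Fintype.card σ - T.card := by
    rw [Fintype.card_subtype_compl, Fintype.card_coe]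
  rw [Finset.card_univ, h2] at h1
  rw [Finset.card_compl]
  change ((Fintype.card σ - T.card : ℕ) : ℕ∞) ≤ m.height at h1
  exact WithBot.coe_le_coe.2 h1

/-- Associated primes of different heights generated by variables obstruct Cohen-Macaulayness. -/
theorem not_isCohenMacaulayRing_of_card_lt [Fintype σ] {I : Ideal (MvPolynomial σ K)}
    {S T : Finset σ} (hcard : T.card < S.card) (hT : I ≤ varsIdeal K T)
    (hS : varsIdeal K S ∈ associatedPrimes (MvPolynomial σ K) (MvPolynomial σ K ⧸ I)) :
    ¬ IsCohenMacaulayRing (MvPolynomial σ K ⧸ I) := by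
  classical
  rintro ⟨-, h⟩
  have hIu : RingHom.ker (Ideal.Quotient.mk I) ≤ varsIdeal K Set.univ := by
    rw [Ideal.mk_ker]
    exact hT.trans (varsIdeal_mono (Set.subset_univ _))
  have hmax : (varsIdeal K (Set.univ : Set σ)).IsMaximal := by
    rw [← ker_eq_varsIdeal (aeval fun _ => (0 : K)) (Algebra.ofId K _) (by simp) (by simp)]
    exact RingHom.ker_isMaximal_of_surjective _ fun c => ⟨C c, by simp⟩
  let m := (varsIdeal K Set.univ).map (Ideal.Quotient.mk I)
  have hm : m.IsMaximal := Ideal.IsMaximal.map_of_surjective_of_ker_le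
    Ideal.Quotient.mk_surjective hIu
  have hmc : m.comap (Ideal.Quotient.mk I) = varsIdeal K Set.univ := by
    rw [Ideal.comap_map_of_surjective' _ Ideal.Quotient.mk_surjective, sup_eq_left]
    exact hIu
  -- At the origin, depth is at most `card σ - card S`, while dimension is at least `card σ - card
  -- T`, which is larger.
  have h1 := localRingDepth_quotient_le_coheight I m (varsPoint K S) hS
    (by rw [hmc]; exact varsIdeal_mono (Set.subset_univ _))
  have h2 := card_compl_le_ringKrullDim_localization K hT m hmc
  rw [← h m] at h2
  have h3 : (Tᶜ.card : ℕ∞) ≤ localRingDepth (Localization.AtPrime m) := by exact_mod_cast h2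
  have h4 := (add_le_add_left (h3.trans h1) (S.card : ℕ∞)).trans (coheight_varsPoint_le K S)
  have h5 : Tᶜ.card + S.card ≤ Fintype.card σ := by exact_mod_cast h4
  rw [Finset.card_compl] at h5
  have := T.card_le_univ
  omega

end Height

/-! ### Regular elements inside an arbitrary maximal ideal. -/

section RegularElements

variable {σ K : Type*} [Field K]

/-- Modulo the prime, `u` becomes the variable `X p`, which is transcendental over `K`, so `P(u)` is
nonzero in a domain. -/
theorem mem_varsIdeal_of_aeval_mul_mem {S : Set σ} {p : σ} (hp : p ∉ S)
    {u : MvPolynomial σ K} (hu : u - X p ∈ varsIdeal K S) {P : Polynomial K} (hP : P ≠ 0)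
    {x : MvPolynomial σ K} (hx : Polynomial.aeval u P * x ∈ varsIdeal K S) :
    x ∈ varsIdeal K S := by
  classical
  let φ : MvPolynomial σ K →ₐ[K] MvPolynomial σ K := aeval fun i => if i ∈ S then 0 else X i
  have hker : RingHom.ker φ = varsIdeal K S :=
    ker_eq_varsIdeal φ (AlgHom.id K _) (fun i hi => by simp [φ, hi]) (fun i hi => by simp [φ, hi])
  rw [← hker, RingHom.mem_ker] at hu hx ⊢
  rw [map_sub, sub_eq_zero] at hu
  rw [map_mul, ← Polynomial.aeval_algHom_apply, hu] at hx
  refine (mul_eq_zero.1 hx).resolve_left fun h => hP ?_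
  simp only [φ, aeval_X, if_neg hp] at h
  exact transcendental_iff.1 (MvPolynomial.transcendental_X K p) P h

/-- The quotient is `K[X p][X q]`. There `P(u)` is a prime constant and `Q(v)` is monic in the outer
variable, hence not divisible by it. -/
theorem exists_sub_mul_mem_varsIdeal {S : Set σ} {p q : σ} (hpq : p ≠ q)
    (hS : ∀ i, i ∉ S ↔ i = p ∨ i = q) {u v : MvPolynomial σ K}
    (hu : u - X p ∈ varsIdeal K S) (hv : v - X q ∈ varsIdeal K S) {P Q : Polynomial K}
    (hP : Irreducible P) (hQ : Q.Monic) {x y : MvPolynomial σ K}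
    (hx : Polynomial.aeval v Q * x - Polynomial.aeval u P * y ∈ varsIdeal K S) :
    ∃ z, x - Polynomial.aeval u P * z ∈ varsIdeal K S := by
  classical
  let φ : MvPolynomial σ K →ₐ[K] Polynomial (Polynomial K) := aeval fun i =>
    if i = p then Polynomial.C Polynomial.X else if i = q then Polynomial.X else 0
  let ψ : Polynomial (Polynomial K) →ₐ[K] MvPolynomial σ K :=
    Polynomial.aevalAeval (X p) (X q)
  have hφp : φ (X p) = Polynomial.C Polynomial.X := by simp [φ]
  have hφq : φ (X q) = Polynomial.X := by simp [φ, hpq.symm]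
  have hψC : ∀ a, ψ (Polynomial.C a) = Polynomial.aeval (X p) a := fun a =>
    Polynomial.aevalAeval_C _ _ a
  have hψX : ψ Polynomial.X = X q := by simp [ψ]
  have hker : RingHom.ker φ = varsIdeal K S := by
    refine ker_eq_varsIdeal φ ψ (fun i hi => ?_) (fun i hi => ?_)
    · have h1 : ¬ (i = p ∨ i = q) := fun h => (hS i).2 h hi
      push Not at h1
      simp [φ, h1.1, h1.2]
    · rcases (hS i).1 hi with rfl | rfl
      · rw [hφp, hψC, Polynomial.aeval_X]
      · rw [hφq, hψX]
  have hsurj : Function.Surjective φ := by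
    have : φ.comp ψ = AlgHom.id K _ := by
      refine Polynomial.algHom_ext' ?_ ?_
      · ext
        simp [hψC, hφp]
      · simp [hψX, hφq]
    exact fun a => ⟨ψ a, DFunLike.congr_fun this a⟩
  rw [← hker, RingHom.mem_ker] at hu hv hx
  rw [map_sub, sub_eq_zero] at hu hv hx
  have hφP : φ (Polynomial.aeval u P) = Polynomial.C P := by
    rw [← Polynomial.aeval_algHom_apply, hu, hφp]
    have := Polynomial.aeval_algHom_apply (Polynomial.CAlgHom (R := K) (A := Polynomial K))
      Polynomial.X P
    simpa using this
  have hφQ : φ (Polynomial.aeval v Q) = Q.map Polynomial.C := by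
    rw [← Polynomial.aeval_algHom_apply, hv, hφq, Polynomial.aeval_def, Polynomial.map]
    rfl
  rw [map_mul, map_mul, hφP, hφQ] at hx
  have hdvd : Polynomial.C P ∣ φ x := by
    refine ((Polynomial.prime_C_iff.2 hP.prime).dvd_or_dvd ⟨φ y, hx⟩).resolve_left fun h => ?_
    have := (Polynomial.C_dvd_iff_dvd_coeff _ _).1 h Q.natDegree
    rw [Polynomial.coeff_map, hQ.coeff_natDegree, map_one] at this
    exact hP.not_isUnit (isUnit_of_dvd_one this)
  obtain ⟨b, hb⟩ := hdvd
  obtain ⟨z, rfl⟩ := hsurj b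
  refine ⟨z, ?_⟩
  rw [← hker, RingHom.mem_ker, map_sub, map_mul, hφP, hb, sub_self]

/-- The residue field is finite over `K` by the Nullstellensatz, so the minimal polynomial of `u`
works. This covers maximal ideals that are not rational points. -/
theorem exists_irreducible_aeval_mem [Finite σ] (M : Ideal (MvPolynomial σ K)) [M.IsMaximal]
    (u : MvPolynomial σ K) :
    ∃ P : Polynomial K, P.Monic ∧ Irreducible P ∧ Polynomial.aeval u P ∈ M := by
  let := Ideal.Quotient.field M
  have : Module.Finite K (MvPolynomial σ K ⧸ M) := finite_of_finite_type_of_isJacobsonRing _ _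
  have hint : IsIntegral K (Ideal.Quotient.mk M u) := Algebra.IsIntegral.isIntegral _
  refine ⟨minpoly K (Ideal.Quotient.mk M u), minpoly.monic hint, minpoly.irreducible hint, ?_⟩
  rw [← Ideal.Quotient.eq_zero_iff_mem, ← Ideal.Quotient.mkₐ_eq_mk K,
    ← Polynomial.aeval_algHom_apply]
  exact minpoly.aeval _ _

end RegularElements

/-! ### Explicit filtrations for the ideals of short paths. -/

section SmallMonomialIdeals

variable {σ K : Type*} [Field K]

/-- The ideal generated by `xᵢ ^ p * xⱼ ^ q` and the variables in `S`. -/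
theorem hasPrimeFiltration_pow_mul_pow_sup_varsIdeal {i j : σ} (hij : i ≠ j) {S : Set σ}
    (hi : i ∉ S) (hj : j ∉ S) (p q : ℕ)
    (hU : IsUpperSet {m : σ →₀ ℕ | (p ≤ m i ∧ q ≤ m j) ∨ ∃ l ∈ S, m l ≠ 0}) :
    HasPrimeFiltration {varsIdeal K (insert i S), varsIdeal K (insert j S)}
      (restrictSupportIdeal (R := K) _ hU) := by
  classical
  have hadd : ∀ k, k ∉ S → ∀ m : σ →₀ ℕ,
      (∃ l ∈ S, (Finsupp.single k 1 + m : σ →₀ ℕ) l ≠ 0) ↔ ∃ l ∈ S, m l ≠ 0 := by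
    intro k hk m
    refine exists_congr fun l => and_congr_right fun hl => ?_
    have : k ≠ l := by
      rintro rfl
      exact hk hl
    simp [this]
  have hbase : ∀ k, varsIdeal K (insert k S) ∈
      ({varsIdeal K (insert i S), varsIdeal K (insert j S)} : Set (Ideal (MvPolynomial σ K))) →
      ∀ hU₂, HasPrimeFiltration {varsIdeal K (insert i S), varsIdeal K (insert j S)}
      (restrictSupportIdeal (R := K) {m : σ →₀ ℕ | m k ≠ 0 ∨ ∃ l ∈ S, m l ≠ 0} hU₂) := by
    intro k hk hU₂
    rw [restrictSupportIdeal_eq_varsIdeal (S := insert k S) (by simp)]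
    exact .of_mem hk
  induction p generalizing q with
  | zero =>
    induction q with
    | zero => rw [restrictSupportIdeal_eq_top (by simp)]; exact .top
    | succ q ih =>
      refine HasPrimeFiltration.restrictSupportIdeal _
        {m : σ →₀ ℕ | (0 ≤ m i ∧ q ≤ m j) ∨ ∃ l ∈ S, m l ≠ 0}
        {m : σ →₀ ℕ | m j ≠ 0 ∨ ∃ l ∈ S, m l ≠ 0} (Finsupp.single j 1) ?_ ?_ ih (hbase j (by simp))
      · intro m
        rw [Set.mem_ofPred_eq, Set.mem_ofPred_eq, hadd j hj, Finsupp.add_apply, Finsupp.add_apply,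
          Finsupp.single_eq_same]
        refine or_congr ?_ Iff.rfl
        omega
      · intro m
        rw [Set.mem_ofPred_eq, Set.mem_ofPred_eq, Finsupp.single_le_iff, or_right_comm]
        refine or_congr ?_ Iff.rfl
        omega
  | succ p ih =>
    -- Colon by `xᵢ` lowers `p` by one; adding `xᵢ` absorbs the product and leaves a prime.
    refine HasPrimeFiltration.restrictSupportIdeal _
      {m : σ →₀ ℕ | (p ≤ m i ∧ q ≤ m j) ∨ ∃ l ∈ S, m l ≠ 0}
      {m : σ →₀ ℕ | m i ≠ 0 ∨ ∃ l ∈ S, m l ≠ 0} (Finsupp.single i 1) ?_ ?_ (ih q) (hbase i (by simp))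
    · intro m
      rw [Set.mem_ofPred_eq, Set.mem_ofPred_eq, hadd i hi, Finsupp.add_apply, Finsupp.add_apply,
        Finsupp.single_eq_same, Finsupp.single_eq_of_ne hij.symm]
      refine or_congr ?_ Iff.rfl
      omega
    · intro m
      rw [Set.mem_ofPred_eq, Set.mem_ofPred_eq, Finsupp.single_le_iff, or_right_comm]
      refine or_congr ?_ Iff.rfl
      omega

/-- The ideal `(xᵢ ^ p * xⱼ ^ q, xₖ ^ r)`. -/
theorem hasPrimeFiltration_pow_mul_pow_pow {i j k : σ} (hij : i ≠ j) (hik : i ≠ k) (hjk : j ≠ k)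
    (p q r : ℕ) (hU : IsUpperSet {m : σ →₀ ℕ | (p ≤ m i ∧ q ≤ m j) ∨ r ≤ m k}) :
    HasPrimeFiltration {varsIdeal K {i, k}, varsIdeal K {j, k}}
      (restrictSupportIdeal (R := K) _ hU) := by
  induction r with
  | zero => rw [restrictSupportIdeal_eq_top (by simp)]; exact .top
  | succ r ih =>
    refine HasPrimeFiltration.restrictSupportIdeal _
      {m : σ →₀ ℕ | (p ≤ m i ∧ q ≤ m j) ∨ r ≤ m k}
      {m : σ →₀ ℕ | (p ≤ m i ∧ q ≤ m j) ∨ ∃ l ∈ ({k} : Set σ), m l ≠ 0}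
      (Finsupp.single k 1) ?_ ?_ ih
      (hasPrimeFiltration_pow_mul_pow_sup_varsIdeal hij (by simpa) (by simpa) p q)
    · intro m
      simp only [Set.mem_ofPred_eq, Finsupp.add_apply, Finsupp.single_eq_same,
        Finsupp.single_eq_of_ne hik, Finsupp.single_eq_of_ne hjk]
      omega
    · intro m
      simp only [Set.mem_ofPred_eq, Finsupp.single_le_iff, Set.mem_singleton_iff, exists_eq_left]
      omega

theorem HasPrimeFiltration.mono {R : Type*} [CommRing R] {Ps Qs : Set (Ideal R)} (h : Ps ⊆ Qs)
    {I : Ideal R} (hI : HasPrimeFiltration Ps I) : HasPrimeFiltration Qs I := by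
  induction hI with
  | top => exact .top
  | of_mem hp => exact .of_mem (h hp)
  | of_colon f hJ _ _ ih1 ih2 => exact .of_colon f hJ ih1 ih2

/-- The ideal `(x₀ ^ a * x₁ ^ b, x₁ ^ b' * x₂ ^ c', x₂ ^ c * x₃ ^ d)` with `b' ≤ b`, `c' ≤ c`. -/
theorem hasPrimeFiltration_path {x₀ x₁ x₂ x₃ : σ} (h01 : x₀ ≠ x₁) (h02 : x₀ ≠ x₂) (h12 : x₁ ≠ x₂)
    (h13 : x₁ ≠ x₃) (h23 : x₂ ≠ x₃) {a b b' c' c d : ℕ} (hb : b' ≤ b) (hc : c' ≤ c)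
    (hU : IsUpperSet {m : σ →₀ ℕ | (a ≤ m x₀ ∧ b ≤ m x₁) ∨ (b' ≤ m x₁ ∧ c' ≤ m x₂) ∨
      (c ≤ m x₂ ∧ d ≤ m x₃)}) :
    HasPrimeFiltration {varsIdeal K {x₀, x₂}, varsIdeal K {x₁, x₂}, varsIdeal K {x₃, x₁}}
      (restrictSupportIdeal (R := K) _ hU) := by
  -- The colon by `x₁ ^ b'` contains `x₂ ^ c'`, which absorbs the last generator as `c' ≤ c`. Adding
  -- `x₁ ^ b'` absorbs the first two generators as `b' ≤ b`.
  refine HasPrimeFiltration.restrictSupportIdeal _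
    {m : σ →₀ ℕ | (a ≤ m x₀ ∧ b - b' ≤ m x₁) ∨ c' ≤ m x₂}
    {m : σ →₀ ℕ | (c ≤ m x₂ ∧ d ≤ m x₃) ∨ b' ≤ m x₁} (Finsupp.single x₁ b') ?_ ?_
    (fun hU₁ => (hasPrimeFiltration_pow_mul_pow_pow h01 h02 h12 _ _ _ hU₁).mono ?_)
    (fun hU₂ => (hasPrimeFiltration_pow_mul_pow_pow h23 h12.symm h13.symm _ _ _ hU₂).mono ?_)
  · intro m
    simp only [Set.mem_ofPred_eq, Finsupp.add_apply, Finsupp.single_eq_same,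
      Finsupp.single_eq_of_ne h01, Finsupp.single_eq_of_ne h12.symm,
      Finsupp.single_eq_of_ne h13.symm]
    omega
  · intro m
    simp only [Set.mem_ofPred_eq, Finsupp.single_le_iff]
    omega
  · rintro p (rfl | rfl) <;> simp
  · rintro p (rfl | rfl) <;> simp [Set.pair_comm]

end SmallMonomialIdeals

/-! ### Unmixedness and Cohen–Macaulayness from the filtrations. -/

section UnmixedAndCohenMacaulay

variable {σ K : Type*} [Field K]

theorem HasPrimeFiltration.isUnmixed {R : Type*} [CommRing R] [IsNoetherianRing R]
    {Ps : Set (Ideal R)} {c : ℕ} (hPs : ∀ p ∈ Ps, p.IsPrime ∧ p.height = c) {I : Ideal R}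
    (hI : HasPrimeFiltration Ps I) : I.IsUnmixed := by
  have hsub := hI.associatedPrimes_subset fun p hp => (hPs p hp).1
  exact fun p hp q hq => (hPs p (hsub hp)).2.trans (hPs q (hsub hq)).2.symm

theorem HasPrimeFiltration.le_height {R : Type*} [CommRing R]
    {Ps : Set (Ideal R)} {c : ℕ} (hPs : ∀ p ∈ Ps, p.height = c) {I : Ideal R}
    (hI : HasPrimeFiltration Ps I) (Q : Ideal R) (hQ : Q.IsPrime) (hIQ : I ≤ Q) :
    (c : ℕ∞) ≤ Q.height := by
  obtain ⟨p, hp, hpQ⟩ := hI.exists_le hQ hIQ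
  exact (hPs p hp).symm.le.trans (Ideal.height_mono hpQ)

theorem ringKrullDim_mvPolynomial_field [Finite σ] :
    ringKrullDim (MvPolynomial σ K) = (Nat.card σ : ℕ) := by
  rw [MvPolynomial.ringKrullDim_of_isNoetherianRing, ringKrullDim_eq_zero_of_field, zero_add]

theorem height_varsIdeal_singleton [Finite σ] (i : σ) :
    (varsIdeal K ({i} : Set σ)).height = (1 : ℕ) := by
  classical
  simpa using height_varsIdeal K ({i} : Finset σ)

theorem height_varsIdeal_pair [Finite σ] {i j : σ} (hij : i ≠ j) :
    (varsIdeal K ({i, j} : Set σ)).height = (2 : ℕ) := by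
  classical
  have := height_varsIdeal K ({i, j} : Finset σ)
  rwa [Finset.card_pair hij, Finset.coe_pair] at this

/-- The ideal `(x₀ ^ p * x₁ ^ q)` in two variables. -/
theorem isCohenMacaulayRing_and_isUnmixed_two [Finite σ] {x₀ x₁ : σ} (h01 : x₀ ≠ x₁)
    (hσ : Nat.card σ = 2) {p q : ℕ}
    (hU : IsUpperSet {m : σ →₀ ℕ | p ≤ m x₀ ∧ q ≤ m x₁}) :
    IsCohenMacaulayRing (MvPolynomial σ K ⧸ restrictSupportIdeal (R := K) _ hU) ∧
      (restrictSupportIdeal (R := K) _ hU).IsUnmixed := by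
  have hI : HasPrimeFiltration {varsIdeal K {x₀}, varsIdeal K {x₁}}
      (restrictSupportIdeal (R := K) _ hU) := by
    have := hasPrimeFiltration_pow_mul_pow_sup_varsIdeal (K := K) h01 (S := ∅) (by simp) (by simp)
      p q (by simpa using hU)
    simpa using this
  have hht : ∀ p ∈ ({varsIdeal K {x₀}, varsIdeal K {x₁}} : Set (Ideal (MvPolynomial σ K))),
      p.IsPrime ∧ p.height = (1 : ℕ) := by
    rintro p (rfl | rfl)
    · exact ⟨inferInstance, height_varsIdeal_singleton _⟩
    · exact ⟨inferInstance, height_varsIdeal_singleton _⟩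
  refine ⟨isCohenMacaulayRing_quotient (c := 1) (n := 1)
    (ringKrullDim_mvPolynomial_field.trans (by rw [hσ])).le
    (hI.le_height fun p hp => (hht p hp).2) fun M hM _ => ?_, hI.isUnmixed hht⟩
  obtain ⟨P, hP, hPi, hPM⟩ := exists_irreducible_aeval_mem M (X x₀ + X x₁)
  refine ⟨[Polynomial.aeval (X x₀ + X x₁) P], rfl, by simpa using hPM,
    hI.isWeaklyRegular_singleton ?_⟩
  rintro p (rfl | rfl) x hx
  · refine mem_varsIdeal_of_aeval_mul_mem (p := x₁) (by simpa using h01.symm) ?_ hPi.ne_zero hx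
    simp [X_mem_varsIdeal_iff]
  · refine mem_varsIdeal_of_aeval_mul_mem (p := x₀) (by simpa using h01) ?_ hPi.ne_zero hx
    simp [X_mem_varsIdeal_iff]

theorem isCohenMacaulayRing_and_isUnmixed_path [Finite σ] {x₀ x₁ x₂ x₃ : σ} (h01 : x₀ ≠ x₁)
    (h02 : x₀ ≠ x₂) (h03 : x₀ ≠ x₃) (h12 : x₁ ≠ x₂) (h13 : x₁ ≠ x₃) (h23 : x₂ ≠ x₃)
    (hσ : ∀ i, i = x₀ ∨ i = x₁ ∨ i = x₂ ∨ i = x₃) (hcard : Nat.card σ = 4)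
    {a b b' c' c d : ℕ} (hb : b' ≤ b) (hc : c' ≤ c)
    (hU : IsUpperSet {m : σ →₀ ℕ | (a ≤ m x₀ ∧ b ≤ m x₁) ∨ (b' ≤ m x₁ ∧ c' ≤ m x₂) ∨
      (c ≤ m x₂ ∧ d ≤ m x₃)}) :
    IsCohenMacaulayRing (MvPolynomial σ K ⧸ restrictSupportIdeal (R := K) _ hU) ∧
      (restrictSupportIdeal (R := K) _ hU).IsUnmixed := by
  have hI := hasPrimeFiltration_path (K := K) h01 h02 h12 h13 h23 hb hc hU
  have hht : ∀ p ∈ ({varsIdeal K {x₀, x₂}, varsIdeal K {x₁, x₂}, varsIdeal K {x₃, x₁}} :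
      Set (Ideal (MvPolynomial σ K))), p.IsPrime ∧ p.height = (2 : ℕ) := by
    rintro p (rfl | rfl | rfl)
    · exact ⟨inferInstance, height_varsIdeal_pair h02⟩
    · exact ⟨inferInstance, height_varsIdeal_pair h12⟩
    · exact ⟨inferInstance, height_varsIdeal_pair h13.symm⟩
  refine ⟨isCohenMacaulayRing_quotient (c := 2) (n := 2)
    (ringKrullDim_mvPolynomial_field.trans (by rw [hcard])).le
    (hI.le_height fun p hp => (hht p hp).2) fun M hM _ => ?_, hI.isUnmixed hht⟩
  -- Each of the three primes contains exactly one of `x₀, x₁` and exactly one of `x₂, x₃`, so one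
  -- pair of sums serves all of them.
  obtain ⟨P, hP, hPi, hPM⟩ := exists_irreducible_aeval_mem M (X x₀ + X x₁)
  obtain ⟨Q, hQ, hQi, hQM⟩ := exists_irreducible_aeval_mem M (X x₂ + X x₃)
  refine ⟨[Polynomial.aeval (X x₀ + X x₁) P, Polynomial.aeval (X x₂ + X x₃) Q], rfl,
    by simpa using ⟨hPM, hQM⟩, hI.isWeaklyRegular_pair ?_ ?_⟩
  · rintro p (rfl | rfl | rfl) x hx
    · refine mem_varsIdeal_of_aeval_mul_mem (p := x₁) (by simp [h01.symm, h12]) ?_ hPi.ne_zero hx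
      simp [X_mem_varsIdeal_iff]
    · refine mem_varsIdeal_of_aeval_mul_mem (p := x₀) (by simp [h01, h02]) ?_ hPi.ne_zero hx
      simp [X_mem_varsIdeal_iff]
    · refine mem_varsIdeal_of_aeval_mul_mem (p := x₀) (by simp [h01, h03]) ?_ hPi.ne_zero hx
      simp [X_mem_varsIdeal_iff]
  · have hcompl : ∀ {y₀ y₁ p q : σ}, y₀ ≠ p → y₀ ≠ q → y₁ ≠ p → y₁ ≠ q →
        (∀ i, i = y₀ ∨ i = y₁ ∨ i = p ∨ i = q) →
        ∀ i, i ∉ ({y₀, y₁} : Set σ) ↔ i = p ∨ i = q := by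
      intro y₀ y₁ p q h1 h2 h3 h4 h i
      simp only [Set.mem_insert_iff, Set.mem_singleton_iff]
      push Not
      have := h i
      constructor
      · tauto
      · rintro (rfl | rfl)
        · exact ⟨h1.symm, h3.symm⟩
        · exact ⟨h2.symm, h4.symm⟩
    rintro p (rfl | rfl | rfl) x y hx
    · refine exists_sub_mul_mem_varsIdeal h13 (hcompl h01 h03 h12.symm h23 (fun i => by have := hσ i; tauto))
        ?_ ?_ hPi hQ hx <;> simp [X_mem_varsIdeal_iff]
    · refine exists_sub_mul_mem_varsIdeal h03 (hcompl h01.symm h13 h02.symm h23 (fun i => by have := hσ i; tauto))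
        ?_ ?_ hPi hQ hx <;> simp [X_mem_varsIdeal_iff]
    · refine exists_sub_mul_mem_varsIdeal h02 (hcompl h03.symm h23.symm h01.symm h12 (fun i => by have := hσ i; tauto))
        ?_ ?_ hPi hQ hx <;> simp [X_mem_varsIdeal_iff]

end UnmixedAndCohenMacaulay

/-! ### Producing associated primes generated by variables. -/

section AssociatedPrimes

variable {σ K : Type*} [Field K] [Finite σ]

theorem varsIdeal_mem_associatedPrimes_path {x₀ x₁ x₂ x₃ : σ} (h01 : x₀ ≠ x₁)
    (h02 : x₀ ≠ x₂) (h03 : x₀ ≠ x₃) (h12 : x₁ ≠ x₂) (h13 : x₁ ≠ x₃) (h23 : x₂ ≠ x₃)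
    {a b b' c' c d : ℕ} (ha : 0 < a) (hd : 0 < d) (hb : b < b') {U : Set (σ →₀ ℕ)}
    (h : ∀ m : σ →₀ ℕ, m ∈ U ↔ (a ≤ m x₀ ∧ b ≤ m x₁) ∨ (b' ≤ m x₁ ∧ c' ≤ m x₂) ∨
      (c ≤ m x₂ ∧ d ≤ m x₃)) (hU : IsUpperSet U) :
    varsIdeal K {x₀, x₁, x₃} ∈ associatedPrimes (MvPolynomial σ K)
      (MvPolynomial σ K ⧸ restrictSupportIdeal (R := K) U hU) := by
  classical
  -- The witness is one factor short in `x₀`, `x₁` and `x₃`, with enough `x₂` for both generators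
  -- involving it. As `b ≤ b' - 1`, one more `x₀` already reaches the first generator, and powers of
  -- `x₂` never help.
  refine varsIdeal_mem_associatedPrimes (Finsupp.single x₀ (a - 1) + Finsupp.single x₁ (b' - 1) +
    Finsupp.single x₂ (c + c') + Finsupp.single x₃ (d - 1)) fun m => ?_
  rw [h]
  simp [h01, h02, h03, h12, h13, h23, h01.symm, h02.symm, h03.symm,
    h12.symm, h13.symm, h23.symm]
  omega

/-- A minimal vertex cover generates an associated prime. -/
theorem varsIdeal_mem_associatedPrimes_of_minimal {U : Set (σ →₀ ℕ)} (hU : IsUpperSet U)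
    {S : Set σ} (hcover : ∀ m ∈ U, ∃ i ∈ S, m i ≠ 0)
    (hmin : ∀ i ∈ S, ∃ j, j ∉ S ∧ ∃ a b, Finsupp.single i a + Finsupp.single j b ∈ U) :
    varsIdeal K S ∈ associatedPrimes (MvPolynomial σ K)
      (MvPolynomial σ K ⧸ restrictSupportIdeal (R := K) U hU) := by
  classical
  apply Module.associatedPrimes.minimalPrimes_annihilator_subset_associatedPrimes
  rw [Ideal.annihilator_quotient]
  refine ⟨⟨inferInstance, fun f hf => ?_⟩, fun Q ⟨hQ, hIQ⟩ hQS => ?_⟩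
  · rw [mem_restrictSupportIdeal_iff] at hf
    exact mem_varsIdeal_iff.2 fun m hm => hcover m (hf m hm)
  · rw [varsIdeal, Ideal.span_le]
    rintro _ ⟨i, hi, rfl⟩
    -- A smaller prime `Q` contains `xᵢ ^ a * xⱼ ^ b` but not `xⱼ`, because `j ∉ S`; hence it
    -- contains `xᵢ`.
    obtain ⟨j, hj, a, b, hab⟩ := hmin i hi
    have hmem : (X i ^ a * X j ^ b : MvPolynomial σ K) ∈ Q := by
      apply hIQ
      rw [X_pow_eq_monomial, X_pow_eq_monomial, monomial_mul, one_mul,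
        mem_restrictSupportIdeal_iff]
      intro m hm
      rw [coeff_monomial] at hm
      split_ifs at hm with h'
      · exact h' ▸ hab
      · exact (hm rfl).elim
    have hjQ : (X j : MvPolynomial σ K) ∉ Q := fun h => hj (X_mem_varsIdeal_iff.1 (hQS h))
    rcases hQ.mem_or_mem hmem with h | h
    · exact hQ.mem_of_pow_mem _ h
    · exact (hjQ (hQ.mem_of_pow_mem _ h)).elim

end AssociatedPrimes

/-! ### Edge ideals of weighted oriented paths. -/

namespace WeightedOrientedGraph

section EdgeIdeal

variable {V : Type*} (D : WeightedOrientedGraph V)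

theorem isUpperSet_edgeExponents :
    IsUpperSet {m : V →₀ ℕ | ∃ x y, D.Adj x y ∧ 1 ≤ m x ∧ D.weight y ≤ m y} := by
  rintro a b hab ⟨x, y, hxy, hx, hy⟩
  exact ⟨x, y, hxy, hx.trans (hab x), hy.trans (hab y)⟩

theorem edgeIdeal_eq_restrictSupportIdeal (K : Type*) [Field K] :
    D.edgeIdeal K = restrictSupportIdeal (R := K) _ D.isUpperSet_edgeExponents := by
  classical
  have hset : {f : MvPolynomial V K | ∃ x y, D.Adj x y ∧ f = X x * X y ^ D.weight y} =
      (fun s => monomial s 1) '' {s : V →₀ ℕ | ∃ x y, D.Adj x y ∧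
        s = Finsupp.single x 1 + Finsupp.single y (D.weight y)} := by
    ext f
    constructor
    · rintro ⟨x, y, hxy, rfl⟩
      refine ⟨_, ⟨x, y, hxy, rfl⟩, ?_⟩
      rw [X_pow_eq_monomial, X, monomial_mul, one_mul]
    · rintro ⟨_, ⟨x, y, hxy, rfl⟩, rfl⟩
      refine ⟨x, y, hxy, ?_⟩
      rw [X_pow_eq_monomial, X, monomial_mul, one_mul]
  ext f
  rw [edgeIdeal, hset, mem_ideal_span_monomial_image, mem_restrictSupportIdeal_iff]
  refine forall_congr' fun m => ?_
  rw [mem_support_iff]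
  refine imp_congr_right fun _ => ?_
  constructor
  · rintro ⟨_, ⟨x, y, hxy, rfl⟩, hle⟩
    have hne : x ≠ y := by
      rintro rfl
      exact D.asymm _ _ hxy hxy
    refine ⟨x, y, hxy, ?_, ?_⟩
    · simpa [hne, hne.symm] using hle x
    · simpa [hne, hne.symm] using hle y
  · rintro ⟨x, y, hxy, hx, hy⟩
    have hne : x ≠ y := by
      rintro rfl
      exact D.asymm _ _ hxy hxy
    refine ⟨_, ⟨x, y, hxy, rfl⟩, fun z => ?_⟩
    rw [Finsupp.add_apply]
    by_cases hzx : z = x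
    · subst hzx
      simpa [hne] using hx
    · by_cases hzy : z = y
      · subst hzy
        simpa [hzx] using hy
      · simp [hzx, hzy]

end EdgeIdeal

section Path

variable {V : Type*} {D : WeightedOrientedGraph V} {k : ℕ}
  (x : SimpleGraph.pathGraph k ≃g D.underlyingGraph)

theorem adj_or_adj_iff (i j : Fin k) :
    D.Adj (x i) (x j) ∨ D.Adj (x j) (x i) ↔ i.val + 1 = j.val ∨ j.val + 1 = i.val := by
  rw [← SimpleGraph.pathGraph_adj, ← x.map_adj_iff]
  have : D.underlyingGraph.Adj (x i) (x j) ↔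
      x i ≠ x j ∧ (D.Adj (x i) (x j) ∨ D.Adj (x j) (x i)) := Iff.rfl
  rw [this, iff_and_self]
  intro h heq
  rw [heq, or_self] at h
  exact D.asymm _ _ h h

/-- The orientation is absorbed into exponents `α i`, `β i` of the two ends of the edge from `i` to
`i + 1`, so later arguments need not split on it. Values beyond the last edge are irrelevant. -/
theorem exists_exponents :
    ∃ α β : ℕ → ℕ,
      (∀ i (h : i + 1 < k),
        (D.Adj (x ⟨i, by omega⟩) (x ⟨i + 1, h⟩) ∧ α i = 1 ∧ β i = D.weight (x ⟨i + 1, h⟩)) ∨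
        (D.Adj (x ⟨i + 1, h⟩) (x ⟨i, by omega⟩) ∧ α i = D.weight (x ⟨i, by omega⟩) ∧ β i = 1)) ∧
      ∀ m : V →₀ ℕ, (∃ a b, D.Adj a b ∧ 1 ≤ m a ∧ D.weight b ≤ m b) ↔
        ∃ i, ∃ h : i + 1 < k, α i ≤ m (x ⟨i, by omega⟩) ∧ β i ≤ m (x ⟨i + 1, h⟩) := by
  have hex : ∀ i, ∃ a b, ∀ h : i + 1 < k,
      (D.Adj (x ⟨i, by omega⟩) (x ⟨i + 1, h⟩) ∧ a = 1 ∧ b = D.weight (x ⟨i + 1, h⟩)) ∨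
      (D.Adj (x ⟨i + 1, h⟩) (x ⟨i, by omega⟩) ∧ a = D.weight (x ⟨i, by omega⟩) ∧ b = 1) := by
    intro i
    by_cases h : i + 1 < k
    · rcases (adj_or_adj_iff x ⟨i, by omega⟩ ⟨i + 1, h⟩).2 (Or.inl rfl) with h' | h'
      · exact ⟨1, D.weight (x ⟨i + 1, h⟩), fun _ => Or.inl ⟨h', rfl, rfl⟩⟩
      · exact ⟨D.weight (x ⟨i, by omega⟩), 1, fun _ => Or.inr ⟨h', rfl, rfl⟩⟩
    · exact ⟨0, 0, fun h' => (h h').elim⟩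
  choose α β hαβ using hex
  refine ⟨α, β, hαβ, fun m => ⟨?_, ?_⟩⟩
  · rintro ⟨a, b, hab, ha, hb⟩
    obtain ⟨⟨i, hi⟩, rfl⟩ := x.surjective a
    obtain ⟨⟨j, hj⟩, rfl⟩ := x.surjective b
    rcases (adj_or_adj_iff x ⟨i, hi⟩ ⟨j, hj⟩).1 (Or.inl hab) with h | h
    · obtain rfl : i + 1 = j := h
      rcases hαβ i hj with ⟨-, h1, h2⟩ | ⟨h, -⟩
      · exact ⟨i, hj, h1.le.trans ha, h2.le.trans hb⟩
      · exact (D.asymm _ _ hab h).elim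
    · obtain rfl : j + 1 = i := h
      rcases hαβ j hi with ⟨h, -⟩ | ⟨-, h1, h2⟩
      · exact (D.asymm _ _ hab h).elim
      · exact ⟨j, hi, h1.le.trans hb, h2.le.trans ha⟩
  · rintro ⟨i, h, h1, h2⟩
    rcases hαβ i h with ⟨hadj, ha, hb⟩ | ⟨hadj, ha, hb⟩
    · exact ⟨_, _, hadj, ha.symm.le.trans h1, hb.symm.le.trans h2⟩
    · exact ⟨_, _, hadj, hb.symm.le.trans h2, ha.symm.le.trans h1⟩

theorem exists_edgeIdeal_eq (K : Type*) [Field K] {U : Set (V →₀ ℕ)}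
    (h : ∀ m : V →₀ ℕ, (∃ a b, D.Adj a b ∧ 1 ≤ m a ∧ D.weight b ≤ m b) ↔ m ∈ U) :
    ∃ hU : IsUpperSet U, D.edgeIdeal K = restrictSupportIdeal (R := K) U hU := by
  obtain rfl : {m : V →₀ ℕ | ∃ x y, D.Adj x y ∧ 1 ≤ m x ∧ D.weight y ≤ m y} = U := Set.ext h
  exact ⟨D.isUpperSet_edgeExponents, D.edgeIdeal_eq_restrictSupportIdeal K⟩

/-- A minimal vertex cover of a path generates an associated prime of the edge ideal. -/
theorem varsIdeal_image_mem_associatedPrimes (K : Type*) [Field K] [Finite V] {S : Set (Fin k)}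
    (hcover : ∀ i (h : i + 1 < k), (⟨i, by omega⟩ : Fin k) ∈ S ∨ (⟨i + 1, h⟩ : Fin k) ∈ S)
    (hmin : ∀ i ∈ S, ∃ j, j ∉ S ∧ (i.val + 1 = j.val ∨ j.val + 1 = i.val)) :
    varsIdeal K (x '' S) ∈ associatedPrimes (MvPolynomial V K)
      (MvPolynomial V K ⧸ D.edgeIdeal K) := by
  rw [edgeIdeal_eq_restrictSupportIdeal]
  apply varsIdeal_mem_associatedPrimes_of_minimal
  · rintro m ⟨a, b, hab, ha, hb⟩
    have hb' := (D.weight_pos b).trans_le hb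
    obtain ⟨⟨i, hi⟩, rfl⟩ := x.surjective a
    obtain ⟨⟨j, hj⟩, rfl⟩ := x.surjective b
    have hcov : (⟨i, hi⟩ : Fin k) ∈ S ∨ (⟨j, hj⟩ : Fin k) ∈ S := by
      rcases (adj_or_adj_iff x ⟨i, hi⟩ ⟨j, hj⟩).1 (Or.inl hab) with h | h
      · obtain rfl : i + 1 = j := h
        exact hcover i hj
      · obtain rfl : j + 1 = i := h
        exact (hcover j hi).symm
    rcases hcov with h | h
    · exact ⟨_, Set.mem_image_of_mem x h, by omega⟩
    · exact ⟨_, Set.mem_image_of_mem x h, by omega⟩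
  · rintro _ ⟨i, hi, rfl⟩
    obtain ⟨j, hj, hij⟩ := hmin i hi
    have hne : x i ≠ x j := fun h => hj (x.injective h ▸ hi)
    refine ⟨x j, fun h => hj ((x.injective.mem_set_image).1 h), ?_⟩
    rcases (adj_or_adj_iff x i j).2 hij with h | h
    · exact ⟨1, D.weight (x j), x i, x j, h, by simp, by simp⟩
    · exact ⟨D.weight (x i), 1, x j, x i, h, by simp, by simp⟩

theorem isCohenMacaulayRing_and_isUnmixed_edgeIdeal_two (K : Type*) [Field K]
    (x : SimpleGraph.pathGraph 2 ≃g D.underlyingGraph) :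
    IsCohenMacaulayRing (MvPolynomial V K ⧸ D.edgeIdeal K) ∧ (D.edgeIdeal K).IsUnmixed := by
  have : Finite V := Finite.of_equiv _ x.toEquiv
  obtain ⟨α, β, -, hm⟩ := exists_exponents x
  obtain ⟨hU, hI⟩ := D.exists_edgeIdeal_eq K
    (U := {m | α 0 ≤ m (x ⟨0, by omega⟩) ∧ β 0 ≤ m (x ⟨1, by omega⟩)}) fun m => by
      rw [hm]
      constructor
      · rintro ⟨i, h, h1⟩
        obtain rfl : i = 0 := by omega
        exact h1
      · exact fun h => ⟨0, by omega, h⟩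
  rw [hI]
  exact isCohenMacaulayRing_and_isUnmixed_two (by simp [x.injective.ne_iff])
    (Nat.card_eq_of_equiv_fin x.toEquiv.symm) hU

theorem exists_exponents_iff_four (x : SimpleGraph.pathGraph 4 ≃g D.underlyingGraph)
    {α β : ℕ → ℕ} (m : V →₀ ℕ) :
    (∃ i, ∃ h : i + 1 < 4, α i ≤ m (x ⟨i, by omega⟩) ∧ β i ≤ m (x ⟨i + 1, h⟩)) ↔
      (α 0 ≤ m (x 0) ∧ β 0 ≤ m (x 1)) ∨ (α 1 ≤ m (x 1) ∧ β 1 ≤ m (x 2)) ∨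
      (α 2 ≤ m (x 2) ∧ β 2 ≤ m (x 3)) := by
  constructor
  · rintro ⟨i, h, h1⟩
    have : i = 0 ∨ i = 1 ∨ i = 2 := by omega
    rcases this with rfl | rfl | rfl
    · exact Or.inl h1
    · exact Or.inr (Or.inl h1)
    · exact Or.inr (Or.inr h1)
  · rintro (h | h | h)
    · exact ⟨0, by omega, h⟩
    · exact ⟨1, by omega, h⟩
    · exact ⟨2, by omega, h⟩

theorem isCohenMacaulayRing_and_isUnmixed_edgeIdeal_four (K : Type*) [Field K]
    (x : SimpleGraph.pathGraph 4 ≃g D.underlyingGraph)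
    (h1 : D.Adj (x 1) (x 0) → D.weight (x 1) = 1)
    (h2 : D.Adj (x 2) (x 3) → D.weight (x 2) = 1) :
    IsCohenMacaulayRing (MvPolynomial V K ⧸ D.edgeIdeal K) ∧ (D.edgeIdeal K).IsUnmixed := by
  have : Finite V := Finite.of_equiv _ x.toEquiv
  obtain ⟨α, β, hαβ, hm⟩ := exists_exponents x
  obtain ⟨hU, hI⟩ := D.exists_edgeIdeal_eq K
    (U := {m : V →₀ ℕ | (α 0 ≤ m (x 0) ∧ β 0 ≤ m (x 1)) ∨
      (α 1 ≤ m (x 1) ∧ β 1 ≤ m (x 2)) ∨ (α 2 ≤ m (x 2) ∧ β 2 ≤ m (x 3))})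
    fun m => (hm m).trans (exists_exponents_iff_four x m)
  rw [hI]
  have w1 := D.weight_pos (x 1)
  have w2 := D.weight_pos (x 2)
  have e0 := hαβ 0 (by omega)
  have e1 := hαβ 1 (by omega)
  have e2 := hαβ 2 (by omega)
  refine isCohenMacaulayRing_and_isUnmixed_path (x₀ := x 0) (x₁ := x 1) (x₂ := x 2) (x₃ := x 3)
    (by simp [x.injective.ne_iff]) (by simp [x.injective.ne_iff]) (by simp [x.injective.ne_iff])
    (by simp [x.injective.ne_iff]) (by simp [x.injective.ne_iff]) (by simp [x.injective.ne_iff])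
    ?_ (Nat.card_eq_of_equiv_fin x.toEquiv.symm) ?_ ?_ hU
  · intro v
    obtain ⟨i, rfl⟩ := x.surjective v
    fin_cases i <;> simp
  -- This is immediate for an edge into `x 1`; for an edge out of `x 1`, `β 0 = 1` and `h1` supplies
  -- the equality. As `α 1` is `1` or this weight, `α 1 ≤ β 0`.
  · have hb : β 0 = D.weight (x 1) := by
      rcases e0 with ⟨-, -, h⟩ | ⟨h, -, h'⟩
      · exact h
      · exact h'.trans (h1 h).symm
    have ha : α 1 = 1 ∨ α 1 = D.weight (x 1) := e1.imp (fun h => h.2.1) (fun h => h.2.1)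
    omega
  · have ha : α 2 = D.weight (x 2) := by
      rcases e2 with ⟨h, h', -⟩ | ⟨-, h, -⟩
      · exact h'.trans (h2 h).symm
      · exact h
    have hb : β 1 = 1 ∨ β 1 = D.weight (x 2) := e1.symm.imp (fun h => h.2.2) (fun h => h.2.2)
    omega

end Path

end WeightedOrientedGraph

/-! ### Associated primes of different sizes in the remaining cases. -/

namespace WeightedOrientedGraph

section NotUnmixed

variable {V : Type*} {D : WeightedOrientedGraph V}

/-- A path on `k` vertices with `k = 3` or `k ≥ 5` has minimal vertex covers of different sizes. -/
theorem exists_associatedPrimes_card_lt_of_ne {k : ℕ} (K : Type*) [Field K] [Finite V]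
    (x : SimpleGraph.pathGraph k ≃g D.underlyingGraph) (hk : 3 ≤ k) (hk4 : k ≠ 4) :
    ∃ S T : Finset V, T.card < S.card ∧
      varsIdeal K S ∈ associatedPrimes (MvPolynomial V K) (MvPolynomial V K ⧸ D.edgeIdeal K) ∧
      varsIdeal K T ∈ associatedPrimes (MvPolynomial V K) (MvPolynomial V K ⧸ D.edgeIdeal K) := by
  classical
  -- The odd vertices form a minimal cover. Trading vertex 1 for its neighbours 0 and 2 gives
  -- another one, larger by one.
  let T : Finset (Fin k) := Finset.univ.filter fun i => i.val % 2 = 1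
  let S : Finset (Fin k) := insert ⟨0, by omega⟩ (insert ⟨2, by omega⟩ (T.erase ⟨1, by omega⟩))
  have hT : ∀ i : Fin k, i ∈ T ↔ i.val % 2 = 1 := by simp [T]
  have hS : ∀ i : Fin k, i ∈ S ↔ i.val = 0 ∨ i.val = 2 ∨ (i.val ≠ 1 ∧ i.val % 2 = 1) := by
    intro i
    simp only [S, Finset.mem_insert, Finset.mem_erase, hT, Fin.ext_iff, ne_eq]
  have hcard : T.card < S.card := by
    have h1 : (⟨1, by omega⟩ : Fin k) ∈ T := by simp [hT]
    have := Finset.card_erase_add_one h1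
    rw [Finset.card_insert_of_notMem (by simp [hT]), Finset.card_insert_of_notMem (by simp [hT])]
    omega
  refine ⟨S.image x, T.image x, ?_, ?_, ?_⟩
  · rwa [Finset.card_image_of_injective _ x.injective, Finset.card_image_of_injective _ x.injective]
  · rw [Finset.coe_image]
    refine varsIdeal_image_mem_associatedPrimes x K (fun i h => ?_) fun i hi => ?_
    · simp only [Finset.mem_coe, hS]
      omega
    · simp only [Finset.mem_coe, hS] at hi ⊢
      have hik := i.2
      -- Vertex 2 lies in `S`, so vertex 3 is irredundant only because of vertex 4, which exists
      -- since `k ≠ 4`. This is where length 4 is exceptional.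
      by_cases h3 : i.val = 3
      · exact ⟨⟨4, by omega⟩, by simp, Or.inl (by simp [h3])⟩
      · by_cases h0 : i.val = 0
        · exact ⟨⟨1, by omega⟩, by simp, Or.inl (by simp [h0])⟩
        · exact ⟨⟨i.val - 1, by omega⟩, by simp only; omega, Or.inr (by simp only; omega)⟩
  · rw [Finset.coe_image]
    refine varsIdeal_image_mem_associatedPrimes x K (fun i h => ?_) fun i hi => ?_
    · simp only [Finset.mem_coe, hT]
      omega
    · simp only [Finset.mem_coe, hT] at hi ⊢
      exact ⟨⟨i.val - 1, by omega⟩, by simp only; omega, Or.inr (by simp only; omega)⟩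

theorem exists_adj_of_weight_ne_one (hsource : ∀ v, D.IsSource v → D.weight v = 1) {v : V}
    (hv : D.weight v ≠ 1) : ∃ y, D.Adj y v := by
  by_contra h
  push Not at h
  refine hv (hsource v ?_)
  ext y
  simp [h y]

theorem exists_associatedPrimes_card_lt_four (K : Type*) [Field K] [Finite V]
    (hsource : ∀ v, D.IsSource v → D.weight v = 1)
    (x : SimpleGraph.pathGraph 4 ≃g D.underlyingGraph)
    (h : ¬ ((D.Adj (x 1) (x 0) → D.weight (x 1) = 1) ∧
      (D.Adj (x 2) (x 3) → D.weight (x 2) = 1))) :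
    ∃ S T : Finset V, T.card < S.card ∧
      varsIdeal K S ∈ associatedPrimes (MvPolynomial V K) (MvPolynomial V K ⧸ D.edgeIdeal K) ∧
      varsIdeal K T ∈ associatedPrimes (MvPolynomial V K) (MvPolynomial V K ⧸ D.edgeIdeal K) := by
  classical
  have hne : ∀ i j, i ≠ j → x i ≠ x j := fun i j => x.injective.ne
  have hcard3 : ∀ i j l : Fin 4, i ≠ j → i ≠ l → j ≠ l → ({x i, x j, x l} : Finset V).card = 3 :=
    fun i j l hij hil hjl => Finset.card_eq_three.2
      ⟨_, _, _, hne i j hij, hne i l hil, hne j l hjl, rfl⟩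
  have hT : varsIdeal K (({x 1, x 2} : Finset V) : Set V) ∈
      associatedPrimes (MvPolynomial V K) (MvPolynomial V K ⧸ D.edgeIdeal K) := by
    have := varsIdeal_image_mem_associatedPrimes x K (S := {1, 2})
      (fun i h => by
        have : i = 0 ∨ i = 1 ∨ i = 2 := by omega
        rcases this with rfl | rfl | rfl <;> simp [Fin.ext_iff])
      (by
        rintro i (rfl | rfl)
        · exact ⟨0, by decide, by decide⟩
        · exact ⟨3, by decide, by decide⟩)
    rwa [Set.image_pair, ← Finset.coe_pair] at this
  have hT2 : ({x 1, x 2} : Finset V).card = 2 := Finset.card_pair (hne 1 2 (by decide))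
  obtain ⟨α, β, hαβ, hm⟩ := exists_exponents x
  obtain ⟨hU, hI⟩ := D.exists_edgeIdeal_eq K
    (U := {m : V →₀ ℕ | (α 0 ≤ m (x 0) ∧ β 0 ≤ m (x 1)) ∨
      (α 1 ≤ m (x 1) ∧ β 1 ≤ m (x 2)) ∨ (α 2 ≤ m (x 2) ∧ β 2 ≤ m (x 3))})
    fun m => (hm m).trans (exists_exponents_iff_four x m)
  have w := fun v => D.weight_pos v
  have e0 := hαβ 0 (by omega)
  have e1 := hαβ 1 (by omega)
  have e2 := hαβ 2 (by omega)
  have hα0 : 0 < α 0 := by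
    rcases e0 with ⟨-, h, -⟩ | ⟨-, h, -⟩
    · omega
    · exact (w _).trans_eq h.symm
  have hβ2 : 0 < β 2 := by
    rcases e2 with ⟨-, -, h⟩ | ⟨-, -, h⟩
    · exact (w _).trans_eq h.symm
    · omega
  rcases not_and_or.1 h with h | h
  · push Not at h
    obtain ⟨hadj, hw⟩ := h
    refine ⟨{x 0, x 1, x 3}, {x 1, x 2}, ?_, ?_, hT⟩
    · rw [hT2, hcard3 _ _ _ (by decide) (by decide) (by decide)]
      omega
    -- Weight different from 1 means `x 1` is not a source, and its incoming edge cannot come from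
    -- `x 0`. Thus `β 0 = 1 < α 1`.
    have h21 : D.Adj (x 2) (x 1) := by
      obtain ⟨y, hy⟩ := exists_adj_of_weight_ne_one hsource hw
      obtain ⟨i, rfl⟩ := x.surjective y
      have hi := (adj_or_adj_iff x i 1).1 (Or.inl hy)
      fin_cases i
      · exact (D.asymm _ _ hadj hy).elim
      · simp at hi
      · exact hy
      · simp at hi
    have hβ0 : β 0 = 1 := by
      rcases e0 with ⟨h, -⟩ | ⟨-, -, h⟩
      · exact (D.asymm _ _ hadj h).elim
      · exact h
    have hα1 : α 1 = D.weight (x 1) := by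
      rcases e1 with ⟨h, -⟩ | ⟨-, h, -⟩
      · exact (D.asymm _ _ h21 h).elim
      · exact h
    have hlt : β 0 < α 1 := by have := w (x 1); omega
    rw [hI]
    push_cast
    exact varsIdeal_mem_associatedPrimes_path (x₂ := x 2) (hne _ _ (by decide))
      (hne _ _ (by decide)) (hne _ _ (by decide)) (hne _ _ (by decide)) (hne _ _ (by decide))
      (hne _ _ (by decide)) hα0 hβ2 hlt (fun m => Iff.rfl) hU
  · push Not at h
    obtain ⟨hadj, hw⟩ := h
    refine ⟨{x 3, x 2, x 0}, {x 1, x 2}, ?_, ?_, hT⟩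
    · rw [hT2, hcard3 _ _ _ (by decide) (by decide) (by decide)]
      omega
    have h12 : D.Adj (x 1) (x 2) := by
      obtain ⟨y, hy⟩ := exists_adj_of_weight_ne_one hsource hw
      obtain ⟨i, rfl⟩ := x.surjective y
      have hi := (adj_or_adj_iff x i 2).1 (Or.inl hy)
      fin_cases i
      · simp at hi
      · exact hy
      · simp at hi
      · exact (D.asymm _ _ hadj hy).elim
    have hα2 : α 2 = 1 := by
      rcases e2 with ⟨-, h, -⟩ | ⟨h, -⟩
      · exact h
      · exact (D.asymm _ _ hadj h).elim
    have hβ1 : β 1 = D.weight (x 2) := by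
      rcases e1 with ⟨-, -, h⟩ | ⟨h, -⟩
      · exact h
      · exact (D.asymm _ _ h12 h).elim
    have hlt : α 2 < β 1 := by have := w (x 2); omega
    rw [hI]
    push_cast
    -- The mirror image of the previous case: the path is read backwards, which swaps the roles of
    -- `α` and `β`.
    refine varsIdeal_mem_associatedPrimes_path (x₂ := x 1) (hne _ _ (by decide))
      (hne _ _ (by decide)) (hne _ _ (by decide)) (hne _ _ (by decide)) (hne _ _ (by decide))
      (hne _ _ (by decide)) (a := β 2) (b := α 2) (b' := β 1) (c' := α 1) (c := β 0) (d := α 0)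
      hβ2 hα0 hlt (fun m => ?_) hU
    rw [Set.mem_ofPred_eq]
    constructor
    · rintro (⟨h1, h2⟩ | ⟨h1, h2⟩ | ⟨h1, h2⟩)
      · exact Or.inr (Or.inr ⟨h2, h1⟩)
      · exact Or.inr (Or.inl ⟨h2, h1⟩)
      · exact Or.inl ⟨h2, h1⟩
    · rintro (⟨h1, h2⟩ | ⟨h1, h2⟩ | ⟨h1, h2⟩)
      · exact Or.inr (Or.inr ⟨h2, h1⟩)
      · exact Or.inr (Or.inl ⟨h2, h1⟩)
      · exact Or.inl ⟨h2, h1⟩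

end NotUnmixed

end WeightedOrientedGraph

/-! ### The equivalence. -/

open WeightedOrientedGraph in
theorem mainTheorem9 {K : Type*} [Field K] {V : Type*} (D : WeightedOrientedGraph V)
    (hsource : ∀ v, D.IsSource v → D.weight v = 1)
    (k : ℕ) (hk : 2 ≤ k) (x : SimpleGraph.pathGraph k ≃g D.underlyingGraph) :
    List.TFAE
      [ IsCohenMacaulayRing (MvPolynomial V K ⧸ D.edgeIdeal K),
        (D.edgeIdeal K).IsUnmixed,
        k = 2 ∨ ∃ h : k = 4,
          (D.Adj (x ⟨1, by omega⟩) (x ⟨0, by omega⟩) → D.weight (x ⟨1, by omega⟩) = 1) ∧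
          (D.Adj (x ⟨2, by omega⟩) (x ⟨3, by omega⟩) → D.weight (x ⟨2, by omega⟩) = 1) ] := by
  classical
  have : Fintype V := Fintype.ofEquiv _ x.toEquiv
  have hpos : (k = 2 ∨ ∃ h : k = 4,
      (D.Adj (x ⟨1, by omega⟩) (x ⟨0, by omega⟩) → D.weight (x ⟨1, by omega⟩) = 1) ∧
      (D.Adj (x ⟨2, by omega⟩) (x ⟨3, by omega⟩) → D.weight (x ⟨2, by omega⟩) = 1)) →
      IsCohenMacaulayRing (MvPolynomial V K ⧸ D.edgeIdeal K) ∧ (D.edgeIdeal K).IsUnmixed := by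
    rintro (rfl | ⟨rfl, h1, h2⟩)
    · exact isCohenMacaulayRing_and_isUnmixed_edgeIdeal_two K x
    · exact isCohenMacaulayRing_and_isUnmixed_edgeIdeal_four K x h1 h2
  have hneg : ¬ (k = 2 ∨ ∃ h : k = 4,
      (D.Adj (x ⟨1, by omega⟩) (x ⟨0, by omega⟩) → D.weight (x ⟨1, by omega⟩) = 1) ∧
      (D.Adj (x ⟨2, by omega⟩) (x ⟨3, by omega⟩) → D.weight (x ⟨2, by omega⟩) = 1)) →
      ¬ IsCohenMacaulayRing (MvPolynomial V K ⧸ D.edgeIdeal K) ∧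
        ¬ (D.edgeIdeal K).IsUnmixed := by
    intro h
    push Not at h
    obtain ⟨S, T, hcard, hS, hT⟩ : ∃ S T : Finset V, T.card < S.card ∧
        varsIdeal K S ∈ associatedPrimes (MvPolynomial V K) (MvPolynomial V K ⧸ D.edgeIdeal K) ∧
        varsIdeal K T ∈
          associatedPrimes (MvPolynomial V K) (MvPolynomial V K ⧸ D.edgeIdeal K) := by
      by_cases h4 : k = 4
      · subst h4
        exact exists_associatedPrimes_card_lt_four K hsource x fun h' => by
          obtain ⟨h1, h2⟩ := h.2 rfl h'.1
          exact h2 (h'.2 h1)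
      · exact exists_associatedPrimes_card_lt_of_ne K x (by omega) h4
    -- Only the containment of `I` in the prime of `T` is needed for the Cohen–Macaulay obstruction;
    -- unmixedness uses that both primes are associated.
    obtain ⟨-, f, hf⟩ := mem_associatedPrimes_quotient_iff.1 hT
    refine ⟨not_isCohenMacaulayRing_of_card_lt K hcard
      (fun r hr => (hf r).2 (Ideal.mul_mem_right f _ hr)) hS, fun hun => ?_⟩
    have := hun _ hS _ hT
    rw [height_varsIdeal, height_varsIdeal] at this
    have : S.card = T.card := by exact_mod_cast this
    omega
  tfae_have 3 → 1 := fun h => (hpos h).1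
  tfae_have 3 → 2 := fun h => (hpos h).2
  tfae_have 1 → 3 := fun h => by_contra fun h' => (hneg h').1 h
  tfae_have 2 → 3 := fun h => by_contra fun h' => (hneg h').2 h
  tfae_finish
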